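/- Let $\nu\ge 1$. Let $W:\mathbb R^\nu\to\mathbb R^\nu$ be $C^1$ (or, if $\nu=1$, continuous and piecewise $C^1$) with $\nabla\cdot W$ bounded, and let $V_1:\mathbb R^\nu\to\mathbb R$ be locally integrable. Put $W^2=|W|^2$ and assume that the negative part of $2V_1-4W^2$ is form-bounded with respect to $-\Delta$ with relative bound less than $1$: there are $0\le a<1$ and $b\in\mathbb R$ with $\int (2V_1-4W^2)_-|u|^2\,dx\le a\|\nabla u\|^2+b\|u\|^2$ for all $u\in H^1(\mathbb R^\nu)$. (This holds, for example, if $V_1$ and $W$ are bounded.) For a real potential $V$ let $-\Delta+V$ denote the operator on $L^2(\mathbb R^\nu;\mathbb C)$ associated with the quadratic form $q_V(u)=\|\nabla u\|^2+\int V|u|^2\,dx$ on the form domain $Q(V)=\{u\in H^1(\mathbb R^\nu): |V|^{1/2}u\in L^2\}$. For self-adjoint $-\Delta+V$ let $E_I$ be its spectral projections, let $N(V)=\dim\operatorname{Ran}E_{(-\infty,0)}(-\Delta+V)\in\{0,1,2,\dots,\infty\}$ (the number of negative eigenvalues, counted with multiplicity, when this is finite), and for $p>0$ let $E_p(V)=\operatorname{Tr}\big([-(-\Delta+V)E_{(-\infty,0]}(-\Delta+V)]^p\big)\in[0,\infty]$.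 Theorem 2.2. The operators $H=-\Delta+V_1+\nabla\cdot W$ and $H_1=-\Delta+2V_1-4W^2$ are self-adjoint, and $$H\ \ge\ \tfrac12 H_1$$ in the sense of quadratic forms, that is, $Q(V_1+\nabla\cdot W)\subset Q(2V_1-4W^2)$ and $q_{V_1+\nabla\cdot W}(u)\ge\tfrac12\, q_{2V_1-4W^2}(u)$ for all $u\in Q(V_1+\nabla\cdot W)$. Moreover $$N(V_1+\nabla\cdot W)\le N(2V_1-4W^2),\qquad E_p(V_1+\nabla\cdot W)\le 2^{-p}E_p(2V_1-4W^2)\quad\text{for all }p>0.$$ -/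

import Mathlib

open MeasureTheory Filter Topology
open scoped ContDiff ENNReal InnerProductSpace ComplexConjugate

noncomputable section

namespace Schrodinger

/-! ## Continuous functional calculus and spectral subspaces of unbounded self-adjoint operators -/

section Abstract

variable {𝓗 : Type*} [NormedAddCommGroup 𝓗] [InnerProductSpace ℂ 𝓗] [CompleteSpace 𝓗]

/-- `T` is a bounded two-sided inverse of `A - z`. -/
def IsResolventAt (A : 𝓗 →ₗ.[ℂ] 𝓗) (z : ℂ) (T : 𝓗 →L[ℂ] 𝓗) : Prop :=
  (∀ f : 𝓗, ∃ h : T f ∈ A.domain, A ⟨T f, h⟩ - z • T f = f) ∧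
    ∀ u : A.domain, T (A u - z • (u : 𝓗)) = u

open Classical in
/-- The resolvent `(A - z)⁻¹` (and `0` if `z` is not in the resolvent set of `A`; the value is used
below only at `z = i`, which is in the resolvent set of every self-adjoint operator). -/
def resolventOp (A : 𝓗 →ₗ.[ℂ] 𝓗) (z : ℂ) : 𝓗 →L[ℂ] 𝓗 :=
  if h : ∃ T, IsResolventAt A z T then h.choose else 0

/-- The operator `f(A)`, for a self-adjoint operator `A` and a function `f` that is continuous on
the spectrum of `A` and tends to `0` at infinity along it. The substitution `w = (λ - i)⁻¹`, that is
`λ = Re (w⁻¹)`, turns functions of `A` into functions of the bounded normal operator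
`(A - i)⁻¹`; the point `w = 0` corresponds to `λ = ∞`. -/
def funCalc (A : 𝓗 →ₗ.[ℂ] 𝓗) (f : ℝ → ℝ) : 𝓗 →L[ℂ] 𝓗 :=
  cfc (fun w : ℂ => if w = 0 then 0 else ((f (w⁻¹).re : ℝ) : ℂ)) (resolventOp A Complex.I)

/-- The spectral subspace `Ran E_U(A)` of a self-adjoint operator `A` for an open set `U` of reals:
the closed span of the ranges of the operators `f(A)`, where `f` is continuous with compact support
contained in `U`. -/
def spectralSubspace (A : 𝓗 →ₗ.[ℂ] 𝓗) (U : Set ℝ) : Submodule ℂ 𝓗 :=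
  (⨆ f ∈ {f : ℝ → ℝ | Continuous f ∧ HasCompactSupport f ∧ tsupport f ⊆ U},
    (funCalc A f).range).topologicalClosure

/-- The number of negative eigenvalues of `A`, counted with multiplicity, in the spectral sense:
the dimension of `Ran E_{(-∞, 0)}(A)`, which is `⊤` if this space has infinite dimension. -/
def numNegative (A : 𝓗 →ₗ.[ℂ] 𝓗) : ℕ∞ :=
  Cardinal.toENat (Module.rank ℂ (spectralSubspace A (Set.Iio 0)))

/-- The trace, in `[0, ∞]`, of a positive bounded operator: the sum of its diagonal matrix elements
in an orthonormal basis. -/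
def traceOp (T : 𝓗 →L[ℂ] 𝓗) : ℝ≥0∞ :=
  ∑' i, ENNReal.ofReal
    (⟪(exists_hilbertBasis ℂ 𝓗).choose_spec.choose i,
      T ((exists_hilbertBasis ℂ 𝓗).choose_spec.choose i)⟫_ℂ).re

/-- `Tr ([-A E_{(-∞, 0]}(A)] ^ p)` for `p > 0`; the operator in the trace is `f(A)` with
`f(λ) = max(-λ, 0) ^ p`. -/
def liebThirring (p : ℝ) (A : 𝓗 →ₗ.[ℂ] 𝓗) : ℝ≥0∞ :=
  traceOp (funCalc A fun t => max (-t) 0 ^ p)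

end Abstract

/-! ## The Schrödinger operator `-Δ + V` -/

variable {ν : ℕ}

/-- The complex Hilbert space `L²(ℝ^ν)`. -/
abbrev L2 (ν : ℕ) : Type := Lp ℂ 2 (volume : Measure (EuclideanSpace ℝ (Fin ν)))

/-- `g ∈ L²` is the `i`-th distributional partial derivative of `u ∈ L²`. -/
def HasWeakPartial (i : Fin ν) (u g : L2 ν) : Prop :=
  ∀ φ : EuclideanSpace ℝ (Fin ν) → ℝ, ContDiff ℝ ∞ φ → HasCompactSupport φ →
    ∫ x, fderiv ℝ φ x (EuclideanSpace.single i 1) • u x = -∫ x, φ x • g x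

theorem integrable_test_smul (u : L2 ν) {ψ : EuclideanSpace ℝ (Fin ν) → ℝ}
    (hψ : Continuous ψ) (hc : HasCompactSupport ψ) : Integrable fun x => ψ x • u x :=
  ((Lp.memLp u).locallyIntegrable (by norm_num)).integrable_smul_left_of_hasCompactSupport hψ hc

theorem integrable_deriv_test_smul (i : Fin ν) (u : L2 ν) {φ : EuclideanSpace ℝ (Fin ν) → ℝ}
    (hφ : ContDiff ℝ ∞ φ) (hc : HasCompactSupport φ) :
    Integrable fun x => fderiv ℝ φ x (EuclideanSpace.single i 1) • u x :=
  integrable_test_smul u ((hφ.continuous_fderiv (by simp)).clm_apply continuous_const)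
    (hc.fderiv_apply (𝕜 := ℝ) _)

theorem HasWeakPartial.add {i : Fin ν} {u v g h : L2 ν} (hu : HasWeakPartial i u g)
    (hv : HasWeakPartial i v h) : HasWeakPartial i (u + v) (g + h) := by
  intro φ hφ hc
  have e1 : (fun x => fderiv ℝ φ x (EuclideanSpace.single i 1) • (u + v : L2 ν) x) =ᵐ[volume]
      fun x => fderiv ℝ φ x (EuclideanSpace.single i 1) • u x +
        fderiv ℝ φ x (EuclideanSpace.single i 1) • v x := by
    filter_upwards [Lp.coeFn_add u v] with x hx
    rw [hx, Pi.add_apply, smul_add]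
  have e2 : (fun x => φ x • (g + h : L2 ν) x) =ᵐ[volume] fun x => φ x • g x + φ x • h x := by
    filter_upwards [Lp.coeFn_add g h] with x hx
    rw [hx, Pi.add_apply, smul_add]
  rw [integral_congr_ae e1, integral_congr_ae e2,
    integral_add (integrable_deriv_test_smul i u hφ hc) (integrable_deriv_test_smul i v hφ hc),
    integral_add (integrable_test_smul g hφ.continuous hc)
      (integrable_test_smul h hφ.continuous hc), hu φ hφ hc, hv φ hφ hc]
  ring

theorem HasWeakPartial.smul {i : Fin ν} {u g : L2 ν} (c : ℂ) (hu : HasWeakPartial i u g) :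
    HasWeakPartial i (c • u) (c • g) := by
  intro φ hφ hc
  have e1 : (fun x => fderiv ℝ φ x (EuclideanSpace.single i 1) • (c • u : L2 ν) x) =ᵐ[volume]
      fun x => c • (fderiv ℝ φ x (EuclideanSpace.single i 1) • u x) := by
    filter_upwards [Lp.coeFn_smul c u] with x hx
    rw [hx, Pi.smul_apply, smul_comm]
  have e2 : (fun x => φ x • (c • g : L2 ν) x) =ᵐ[volume] fun x => c • (φ x • g x) := by
    filter_upwards [Lp.coeFn_smul c g] with x hx
    rw [hx, Pi.smul_apply, smul_comm]
  rw [integral_congr_ae e1, integral_congr_ae e2, integral_smul, integral_smul, hu φ hφ hc,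
    smul_neg]

theorem HasWeakPartial.unique {i : Fin ν} {u g h : L2 ν} (hg : HasWeakPartial i u g)
    (hh : HasWeakPartial i u h) : g = h := by
  refine Lp.ext ?_
  refine ae_eq_of_integral_contDiff_smul_eq ((Lp.memLp g).locallyIntegrable (by norm_num))
    ((Lp.memLp h).locallyIntegrable (by norm_num)) fun φ hφ hc => ?_
  have := (hg φ hφ hc).symm.trans (hh φ hφ hc)
  exact neg_injective this

open Classical in
/-- The weak partial derivative `∂ᵢ u ∈ L²` (and `0` if there is none in `L²`). -/
def weakPartial (i : Fin ν) (u : L2 ν) : L2 ν :=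
  if h : ∃ g, HasWeakPartial i u g then h.choose else 0

theorem HasWeakPartial.weakPartial_eq {i : Fin ν} {u g : L2 ν} (h : HasWeakPartial i u g) :
    weakPartial i u = g := by
  have hex : ∃ g, HasWeakPartial i u g := ⟨g, h⟩
  rw [weakPartial, dif_pos hex]
  exact hex.choose_spec.unique h

/-- The Sobolev space `H¹(ℝ^ν)`. -/
def sobolevH1 (ν : ℕ) : Submodule ℂ (L2 ν) where
  carrier := {u | ∀ i, ∃ g, HasWeakPartial i u g}
  add_mem' hu hv i := by
    obtain ⟨g, hg⟩ := hu i
    obtain ⟨h, hh⟩ := hv i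
    exact ⟨g + h, hg.add hh⟩
  zero_mem' i := ⟨0, fun φ _ _ => by
    have e : ∀ ψ : EuclideanSpace ℝ (Fin ν) → ℝ, ∫ x, ψ x • (0 : L2 ν) x = 0 := fun ψ => by
      rw [integral_congr_ae (g := fun _ => (0 : ℂ)), integral_zero]
      filter_upwards [Lp.coeFn_zero ℂ 2 (volume : Measure (EuclideanSpace ℝ (Fin ν)))] with x hx
      rw [hx, Pi.zero_apply, smul_zero]
    have h := e φ
    rw [h, neg_zero]
    exact e fun x => fderiv ℝ φ x (EuclideanSpace.single i 1)⟩
  smul_mem' c u hu i := by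
    obtain ⟨g, hg⟩ := hu i
    exact ⟨c • g, hg.smul c⟩

theorem hasWeakPartial_weakPartial {u : L2 ν} (hu : u ∈ sobolevH1 ν) (i : Fin ν) :
    HasWeakPartial i u (weakPartial i u) := by
  obtain ⟨g, hg⟩ := hu i
  rwa [hg.weakPartial_eq]

/-- The form domain of `-Δ + V`: all `u ∈ H¹` with `|V|^{1/2} u ∈ L²`. -/
def formDomain (V : EuclideanSpace ℝ (Fin ν) → ℝ) : Submodule ℂ (L2 ν) where
  carrier := {u | u ∈ sobolevH1 ν ∧ MemLp (fun x => √|V x| • u x) 2 volume}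
  add_mem' {u v} hu hv := by
    refine ⟨add_mem hu.1 hv.1, (memLp_congr_ae ?_).2 (hu.2.add hv.2)⟩
    filter_upwards [Lp.coeFn_add u v] with x hx
    rw [hx, Pi.add_apply, Pi.add_apply, smul_add]
  zero_mem' := by
    refine ⟨zero_mem _, (memLp_congr_ae ?_).2 (MemLp.zero' (ε := ℂ))⟩
    filter_upwards [Lp.coeFn_zero ℂ 2 (volume : Measure (EuclideanSpace ℝ (Fin ν)))] with x hx
    rw [hx, Pi.zero_apply, smul_zero]
  smul_mem' c u hu := by
    refine ⟨Submodule.smul_mem _ c hu.1, (memLp_congr_ae ?_).2 (hu.2.const_smul c)⟩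
    filter_upwards [Lp.coeFn_smul c u] with x hx
    rw [hx, Pi.smul_apply, Pi.smul_apply, smul_comm]

/-- The kinetic energy `‖∇u‖²`. -/
def kinetic (u : L2 ν) : ℝ := ∑ i, ‖weakPartial i u‖ ^ 2

/-- The quadratic form `q_V(u) = ‖∇u‖² + ∫ V |u|²` of `-Δ + V`, for `u` in the form domain. -/
def energy (V : EuclideanSpace ℝ (Fin ν) → ℝ) (u : L2 ν) : ℝ :=
  kinetic u + ∫ x, V x * ‖u x‖ ^ 2

/-- The sesquilinear form `q_V(v, u) = ⟨∇v, ∇u⟩ + ∫ conj(v) V u` of `-Δ + V`. -/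
def form (V : EuclideanSpace ℝ (Fin ν) → ℝ) (v u : L2 ν) : ℂ :=
  ∑ i, ⟪weakPartial i v, weakPartial i u⟫_ℂ + ∫ x, conj (v x) * ((V x : ℂ) * u x)

/-- The graph of `-Δ + V` defined as a form sum: the pairs `(u, f)` such that `u` is in the form
domain and `q_V(v, u) = ⟨v, f⟩` for all `v` in the form domain. (For measurable `V` the
integrability clause holds automatically, by the Schwarz inequality.) -/
def graph (V : EuclideanSpace ℝ (Fin ν) → ℝ) : Submodule ℂ (L2 ν × L2 ν) where
  carrier := {z | z.1 ∈ formDomain V ∧ ∀ v ∈ formDomain V,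
    Integrable (fun x => conj (v x) * ((V x : ℂ) * z.1 x)) ∧ form V v z.1 = ⟪v, z.2⟫_ℂ}
  add_mem' {z w} hz hw := by
    refine ⟨add_mem hz.1 hw.1, fun v hv => ?_⟩
    have e : (fun x => conj (v x) * ((V x : ℂ) * (z + w).1 x)) =ᵐ[volume]
        fun x => conj (v x) * ((V x : ℂ) * z.1 x) + conj (v x) * ((V x : ℂ) * w.1 x) := by
      filter_upwards [Lp.coeFn_add z.1 w.1] with x hx
      rw [Prod.fst_add, hx, Pi.add_apply]
      ring
    have hi := (hz.2 v hv).1.add (hw.2 v hv).1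
    refine ⟨(integrable_congr e).2 hi, ?_⟩
    have hd : ∀ i, weakPartial i (z + w).1 = weakPartial i z.1 + weakPartial i w.1 := fun i =>
      ((hasWeakPartial_weakPartial hz.1.1 i).add
        (hasWeakPartial_weakPartial hw.1.1 i)).weakPartial_eq
    rw [form, integral_congr_ae e, integral_add (hz.2 v hv).1 (hw.2 v hv).1, Prod.snd_add,
      inner_add_right, ← (hz.2 v hv).2, ← (hw.2 v hv).2, form, form]
    simp only [hd, inner_add_right, Finset.sum_add_distrib]
    ring
  zero_mem' := by
    refine ⟨zero_mem _, fun v _ => ?_⟩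
    have e : (fun x => conj (v x) * ((V x : ℂ) * (0 : L2 ν) x)) =ᵐ[volume] fun _ => (0 : ℂ) := by
      filter_upwards [Lp.coeFn_zero ℂ 2 (volume : Measure (EuclideanSpace ℝ (Fin ν)))] with x hx
      rw [hx, Pi.zero_apply, mul_zero, mul_zero]
    refine ⟨(integrable_congr e).2 (integrable_zero _ _ _), ?_⟩
    have hd : ∀ i, weakPartial i (0 : L2 ν) = 0 := fun i => by
      have h := ((hasWeakPartial_weakPartial (zero_mem (sobolevH1 ν)) i).smul 0).weakPartial_eq
      rwa [zero_smul, zero_smul] at h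
    rw [form, Prod.fst_zero, integral_congr_ae e]
    simp [hd]
  smul_mem' c z hz := by
    refine ⟨Submodule.smul_mem _ c hz.1, fun v hv => ?_⟩
    have e : (fun x => conj (v x) * ((V x : ℂ) * (c • z).1 x)) =ᵐ[volume]
        fun x => c * (conj (v x) * ((V x : ℂ) * z.1 x)) := by
      filter_upwards [Lp.coeFn_smul c z.1] with x hx
      rw [Prod.smul_fst, hx, Pi.smul_apply, smul_eq_mul]
      ring
    refine ⟨(integrable_congr e).2 ((hz.2 v hv).1.const_mul c), ?_⟩
    have hd : ∀ i, weakPartial i (c • z).1 = c • weakPartial i z.1 := fun i =>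
      ((hasWeakPartial_weakPartial hz.1.1 i).smul c).weakPartial_eq
    rw [form, integral_congr_ae e, integral_const_mul, Prod.smul_snd, inner_smul_right,
      ← (hz.2 v hv).2, form]
    simp only [hd, inner_smul_right, ← Finset.mul_sum]
    ring

/-- The operator `-Δ + V` on `L²(ℝ^ν)`, associated with the form `q_V`. -/
def hamiltonian (V : EuclideanSpace ℝ (Fin ν) → ℝ) : L2 ν →ₗ.[ℂ] L2 ν :=
  (graph V).toLinearPMap

/-- `N(V)`: the number of negative eigenvalues of `-Δ + V`, with multiplicity. -/
def N (V : EuclideanSpace ℝ (Fin ν) → ℝ) : ℕ∞ := numNegative (hamiltonian V)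

/-- `E_p(V)`: the Lieb-Thirring sum of eigenvalue powers of `-Δ + V`. -/
def E (p : ℝ) (V : EuclideanSpace ℝ (Fin ν) → ℝ) : ℝ≥0∞ := liebThirring p (hamiltonian V)

/-- The inequality `-Δ + V ≥ c (-Δ + V')` in the sense of quadratic forms. -/
def FormGE (V : EuclideanSpace ℝ (Fin ν) → ℝ) (c : ℝ) (V' : EuclideanSpace ℝ (Fin ν) → ℝ) : Prop :=
  ∀ u ∈ formDomain V, u ∈ formDomain V' ∧ c * energy V' u ≤ energy V u

/-- The negative part of `V` is form-bounded with respect to `-Δ` with relative bound less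
than `1`. -/
def NegPartFormBounded (V : EuclideanSpace ℝ (Fin ν) → ℝ) : Prop :=
  ∃ a b : ℝ, 0 ≤ a ∧ a < 1 ∧ ∀ u ∈ sobolevH1 ν,
    ∫⁻ x, ENNReal.ofReal (max (-V x) 0 * ‖u x‖ ^ 2) ≤
      ENNReal.ofReal (a * kinetic u + b * ‖u‖ ^ 2)

/-- The (pointwise) divergence of a vector field. -/
def divergence (W : EuclideanSpace ℝ (Fin ν) → EuclideanSpace ℝ (Fin ν))
    (x : EuclideanSpace ℝ (Fin ν)) : ℝ :=
  ∑ i, fderiv ℝ W x (EuclideanSpace.single i 1) i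

/-- A continuous, piecewise `C¹` function on `ℝ`: it is `C¹` away from a locally finite set of
points, and at these its derivative has one-sided limits. -/
def IsPiecewiseC1 {F : Type*} [NormedAddCommGroup F] [NormedSpace ℝ F] (f : ℝ → F) : Prop :=
  Continuous f ∧ ∃ S : Set ℝ, (∀ R : ℝ, (S ∩ Set.Icc (-R) R).Finite) ∧
    (∀ t ∉ S, ContDiffAt ℝ 1 f t) ∧
    ∀ t ∈ S, (∃ l, Tendsto (deriv f) (𝓝[<] t) (𝓝 l)) ∧ ∃ r, Tendsto (deriv f) (𝓝[>] t) (𝓝 r)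

/-- The vector fields under consideration: `C¹` fields on `ℝ^ν`, and, if `ν = 1`, also continuous
piecewise `C¹` ones. -/
def IsRegularField (W : EuclideanSpace ℝ (Fin ν) → EuclideanSpace ℝ (Fin ν)) : Prop :=
  ContDiff ℝ 1 W ∨
    (ν = 1 ∧ ∀ i : Fin ν, IsPiecewiseC1 fun t : ℝ => W (EuclideanSpace.single i t))

end Schrodinger

end

noncomputable section

namespace Schrodinger

/-! ### Operators bounded below, handled through a positive bounded inverse. -/

section Abstract

set_option linter.unusedSectionVars false

variable {𝓗 : Type*} [NormedAddCommGroup 𝓗] [InnerProductSpace ℂ 𝓗] [CompleteSpace 𝓗]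

/-! The form inequality is the expansion of `‖∇u - 2Wu‖² ≥ 0`. Integration by parts gives `∫
(∇·W)|u|² = -2 Re ⟨Wu, ∇u⟩`, so the cross term of the square is `2 ∫ (∇·W)|u|²`, and `‖∇u‖² + 2 ∫
(∇·W)|u|² + 4 ∫ |W|²|u|² ≥ 0`. Adding `‖∇u‖² + 2 ∫ V₁|u|²` and moving the last term across yields
twice the claim. Integration by parts in `H¹` comes from differentiating `t ↦ ∫ φ(x + t e)|u(x)|²`
in two ways (`HasWeakPartial.integral_lineDeriv_mul_norm_sq`), followed by a cutoff argument
(`integral_divergence_mul_norm_sq`).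

For the operators, the form domain with the shifted form as inner product is a Hilbert space `K`. If
`j : K → L²` is the inclusion, then `j j*` is the inverse of `-Δ + V + c`
(`exists_formSpace_hamiltonian`). A positive bounded inverse makes the operator self-adjoint, and
turns `f(A)` into a continuous function of the bounded operator `j j*`
(`IsShiftedInverse.funCalc_eq`).

The spectral comparison is Glazman's lemma. If the form of `A` is at least `κ` times that of `B`, no
nonzero vector spectrally supported below `κ s` for `A` can be orthogonal to the spectral subspace
of `B` below `s`, which bounds the dimensions (`rank_spectralSubspace_le`). At `s = 0` this is the
inequality for `N`. For `E_p`, a layer-cake decomposition of the function of the operator into thin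
slices converts the dimension bounds at all levels into a trace bound
(`traceOp_funCalc_le_of_spectralDim_le`). -/

theorem IsResolventAt.unique {A : 𝓗 →ₗ.[ℂ] 𝓗} {z : ℂ} {T T' : 𝓗 →L[ℂ] 𝓗}
    (h : IsResolventAt A z T) (h' : IsResolventAt A z T') : T = T' := by
  ext f
  obtain ⟨hd, he⟩ := h.1 f
  have := h'.2 ⟨T f, hd⟩
  rw [he] at this
  exact this.symm

theorem IsResolventAt.resolventOp_eq {A : 𝓗 →ₗ.[ℂ] 𝓗} {z : ℂ} {T : 𝓗 →L[ℂ] 𝓗}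
    (h : IsResolventAt A z T) : resolventOp A z = T := by
  have hex : ∃ T, IsResolventAt A z T := ⟨T, h⟩
  rw [resolventOp, dif_pos hex]
  exact hex.choose_spec.unique h

/-- `T` is the inverse of `A + c`, and it is a positive bounded operator. -/
structure IsShiftedInverse (A : 𝓗 →ₗ.[ℂ] 𝓗) (c : ℝ) (T : 𝓗 →L[ℂ] 𝓗) : Prop where
  nonneg : 0 ≤ T
  resolvent : IsResolventAt A (-c : ℂ) T

namespace IsShiftedInverse

variable {A : 𝓗 →ₗ.[ℂ] 𝓗} {c : ℝ} {T : 𝓗 →L[ℂ] 𝓗}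

theorem isSelfAdjoint (h : IsShiftedInverse A c T) : IsSelfAdjoint T :=
  IsSelfAdjoint.of_nonneg h.nonneg

theorem inner_left (h : IsShiftedInverse A c T) (x y : 𝓗) : ⟪T x, y⟫_ℂ = ⟪x, T y⟫_ℂ := by
  have := ContinuousLinearMap.adjoint_inner_left T y x
  rwa [← ContinuousLinearMap.star_eq_adjoint, h.isSelfAdjoint.star_eq] at this

theorem spectrum_nonneg (h : IsShiftedInverse A c T) {t : ℝ} (ht : t ∈ spectrum ℝ T) : 0 ≤ t :=
  spectrum_nonneg_of_nonneg h.nonneg ht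

/-- The range of `T` lies in the domain. So a vector `x` orthogonal to the domain has `T x = 0` by
symmetry of `T`, and applying `A + c` gives `x = 0`. -/
theorem dense_domain (h : IsShiftedInverse A c T) : Dense (A.domain : Set 𝓗) := by
  rw [Submodule.dense_iff_topologicalClosure_eq_top, Submodule.topologicalClosure_eq_top_iff,
    Submodule.eq_bot_iff]
  intro x hx
  have hT : T x = 0 := by
    refine ext_inner_left ℂ fun y => ?_
    rw [inner_zero_right, ← h.inner_left]
    exact (Submodule.mem_orthogonal _ _).1 hx _ (h.resolvent.1 y).1
  obtain ⟨hd, he⟩ := h.resolvent.1 x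
  have h0 : (⟨T x, hd⟩ : A.domain) = 0 := Subtype.ext hT
  rw [h0, LinearPMap.map_zero, hT, smul_zero, sub_zero] at he
  exact he.symm

theorem exists_apply_eq (h : IsShiftedInverse A c T) (u : A.domain) :
    T (A u + (c : ℂ) • (u : 𝓗)) = u := by
  have := h.resolvent.2 u
  rwa [neg_smul, sub_neg_eq_add] at this

/-- `A` inherits symmetry from `T`, and `A + c` is onto. For `y` in the domain of the adjoint,
testing against vectors `T f` shows `y = T (A* y + c y)`, which lies in the domain of `A`. -/
theorem isSelfAdjoint_generator (h : IsShiftedInverse A c T) : IsSelfAdjoint A := by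
  have hle : A ≤ A.adjoint := by
    refine LinearPMap.IsFormalAdjoint.le_adjoint h.dense_domain fun u v => ?_
    have hu := h.exists_apply_eq u
    have hv := h.exists_apply_eq v
    have e := h.inner_left (A u + (c : ℂ) • (u : 𝓗)) (A v + (c : ℂ) • (v : 𝓗))
    rw [hu, hv, inner_add_left, inner_add_right, inner_smul_left, inner_smul_right,
      Complex.conj_ofReal] at e
    exact (add_right_cancel e).symm
  rw [LinearPMap.isSelfAdjoint_def]
  refine le_antisymm ?_ hle
  have hdom : A.adjoint.domain ≤ A.domain := by
    intro y hy
    have key : T (A.adjoint ⟨y, hy⟩ + (c : ℂ) • y) = y := by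
      refine ext_inner_right ℂ fun f => ?_
      obtain ⟨hd, he⟩ := h.resolvent.1 f
      have e := LinearPMap.adjoint_isFormalAdjoint h.dense_domain ⟨y, hy⟩ ⟨T f, hd⟩
      have hA : A ⟨T f, hd⟩ = f - (c : ℂ) • T f := by
        rw [neg_smul, sub_neg_eq_add] at he
        exact eq_sub_of_add_eq he
      rw [hA, inner_sub_right, inner_smul_right] at e
      rw [h.inner_left, inner_add_left, inner_smul_left, Complex.conj_ofReal]
      exact eq_sub_iff_add_eq.1 e
    rw [← key]
    exact (h.resolvent.1 _).1
  refine ⟨hdom, fun y x hyx => ?_⟩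
  exact (hle.2 (x := x) (y := y) hyx.symm).symm

end IsShiftedInverse

/-! ### Functional calculus of the operator as a functional calculus of its shifted inverse. -/

/-- The function of `t = (λ + c)⁻¹` corresponding to the function `f` of `λ`. -/
def transfer (c : ℝ) (f : ℝ → ℝ) (t : ℝ) : ℝ := if t = 0 then 0 else f (t⁻¹ - c)

/-- The only delicate point is `t = 0`, approached from the right: there `t⁻¹ - c` tends to `+∞`,
where `f` vanishes. The behaviour of `f` at `-∞` plays no role, since `t` stays nonnegative. -/
theorem continuousOn_transfer (c : ℝ) {f : ℝ → ℝ} (hf : Continuous f)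
    (h0 : ∀ᶠ t in atTop, f t = 0) : ContinuousOn (transfer c f) (Set.Ici 0) := by
  intro t ht
  rcases eq_or_lt_of_le (Set.mem_Ici.1 ht) with rfl | hpos
  · have h1 : ∀ᶠ s in 𝓝[>] (0 : ℝ), f (s⁻¹ - c) = 0 :=
      (tendsto_atTop_add_const_right _ (-c) tendsto_inv_nhdsGT_zero).eventually h0
    have h2 : ∀ᶠ s in 𝓝[Set.Ici 0] (0 : ℝ), transfer c f s = 0 := by
      rw [eventually_nhdsWithin_iff] at h1 ⊢
      filter_upwards [h1] with s hs hs0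
      rcases eq_or_lt_of_le (Set.mem_Ici.1 hs0) with rfl | hs'
      · simp [transfer]
      · simp [transfer, hs'.ne', hs hs']
    have h3 : transfer c f 0 = 0 := by simp [transfer]
    rw [ContinuousWithinAt, h3]
    exact tendsto_const_nhds.congr' (h2.mono fun _ h => h.symm)
  · have h1 : ContinuousAt (fun s => f (s⁻¹ - c)) t :=
      hf.continuousAt.comp ((continuousAt_inv₀ hpos.ne').sub continuousAt_const)
    refine (h1.congr ?_).continuousWithinAt
    filter_upwards [lt_mem_nhds hpos] with s hs
    simp [transfer, hs.ne']

theorem one_sub_mul_ofReal_ne_zero (c t : ℝ) : 1 - (c + Complex.I) * (t : ℂ) ≠ 0 := by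
  intro h
  have him := congrArg Complex.im h
  have hre := congrArg Complex.re h
  simp at him hre
  rw [him] at hre
  simp at hre

/-- The resolvent at `i` as a function of `t = (λ + c)⁻¹`. -/
def resolventFun (c : ℝ) (z : ℂ) : ℂ := z * (1 - (c + Complex.I) * z)⁻¹

/-- From `A - i = (A + c) - (c + i)` one gets `(A - i)⁻¹ = T (1 - (c + i) T)⁻¹`. The inverse exists
because `1 - (c + i) t` has no real zero and the spectrum of `T` is real. -/
theorem IsShiftedInverse.isResolventAt_I {A : 𝓗 →ₗ.[ℂ] 𝓗} {c : ℝ} {T : 𝓗 →L[ℂ] 𝓗}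
    (h : IsShiftedInverse A c T) : IsResolventAt A Complex.I (cfc (resolventFun c) T) := by
  have hsa := h.isSelfAdjoint
  have hn : IsStarNormal T := hsa.isStarNormal
  have hne : ∀ z ∈ spectrum ℂ T, 1 - (c + Complex.I) * z ≠ 0 := fun z hz => by
    rw [hsa.mem_spectrum_eq_re hz]
    exact one_sub_mul_ofReal_ne_zero c _
  have hcont : ContinuousOn (fun z : ℂ => (1 - (c + Complex.I) * z)⁻¹) (spectrum ℂ T) :=
    ContinuousOn.inv₀ (by fun_prop) hne
  set X : 𝓗 →L[ℂ] 𝓗 := cfc (fun z : ℂ => (1 - (c + Complex.I) * z)⁻¹) T with hX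
  have hlin : cfc (fun z : ℂ => 1 - (c + Complex.I) * z) T = 1 - (c + Complex.I) • T := by
    rw [cfc_sub (fun _ : ℂ => (1 : ℂ)) (fun z : ℂ => (c + Complex.I) * z) T, cfc_const_one ℂ T,
      cfc_const_mul_id (c + Complex.I) T]
  have hR : cfc (resolventFun c) T = T * X := by
    have := cfc_mul (fun z : ℂ => z) (fun z : ℂ => (1 - (c + Complex.I) * z)⁻¹) T
      (by fun_prop) hcont
    rw [cfc_id' ℂ T] at this
    exact this
  have hinv : X * (1 - (c + Complex.I) • T) = 1 := by
    rw [← hlin, hX, ← cfc_mul _ _ T hcont (by fun_prop)]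
    rw [cfc_congr (g := fun _ : ℂ => (1 : ℂ)) fun z hz => inv_mul_cancel₀ (hne z hz)]
    exact cfc_const_one ℂ T
  have hinv' : (1 - (c + Complex.I) • T) * X = 1 := by
    rw [← hlin, hX, ← cfc_mul _ _ T (by fun_prop) hcont]
    rw [cfc_congr (g := fun _ : ℂ => (1 : ℂ)) fun z hz => mul_inv_cancel₀ (hne z hz)]
    exact cfc_const_one ℂ T
  rw [hR]
  refine ⟨fun f => ?_, fun u => ?_⟩
  · obtain ⟨hd, he⟩ := h.resolvent.1 (X f)
    refine ⟨hd, ?_⟩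
    have e := DFunLike.congr_fun hinv' f
    simp only [mul_apply_eq_comp, sub_apply,
      one_apply_eq_self, smul_apply] at e
    rw [neg_smul, sub_neg_eq_add] at he
    have he' := eq_sub_of_add_eq he
    change A ⟨T (X f), hd⟩ - Complex.I • T (X f) = f
    rw [he']
    refine Eq.trans ?_ e
    rw [add_smul]
    abel
  · have e := h.exists_apply_eq u
    set g : 𝓗 := A u + (c : ℂ) • (u : 𝓗) with hg
    have e2 : A u - Complex.I • (u : 𝓗) = (1 - (c + Complex.I) • T) g := by
      simp only [sub_apply, one_apply_eq_self,
        smul_apply]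
      rw [e, hg, add_smul]
      abel
    rw [e2, mul_apply_eq_comp]
    have e3 := DFunLike.congr_fun hinv g
    rw [mul_apply_eq_comp] at e3
    rw [e3]
    exact e

theorem resolventFun_ofReal_inv (c : ℝ) {t : ℝ} (ht : t ≠ 0) :
    (resolventFun c t)⁻¹ = (t⁻¹ - c : ℝ) - Complex.I := by
  have ht' : (t : ℂ) ≠ 0 := by exact_mod_cast ht
  rw [resolventFun, mul_inv, inv_inv]
  push_cast
  field_simp
  ring

/-- With `w = resolventFun c t` one has `w⁻¹ = λ - i` for `λ = t⁻¹ - c`, so the function of `w` in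
`funCalc` composed with `resolventFun c` is `transfer c f`. The rest is continuity on the spectra,
as required for composing functional calculi. -/
theorem IsShiftedInverse.funCalc_eq {A : 𝓗 →ₗ.[ℂ] 𝓗} {c : ℝ} {T : 𝓗 →L[ℂ] 𝓗}
    (h : IsShiftedInverse A c T) {f : ℝ → ℝ} (hf : Continuous f) (h0 : ∀ᶠ t in atTop, f t = 0) :
    funCalc A f = cfc (transfer c f) T := by
  have hsa := h.isSelfAdjoint
  have hn : IsStarNormal T := hsa.isStarNormal
  rw [funCalc, h.isResolventAt_I.resolventOp_eq]
  have hspec : ∀ z ∈ spectrum ℂ T, ∃ t : ℝ, 0 ≤ t ∧ z = t := fun z hz => by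
    have hz' := hsa.mem_spectrum_eq_re hz
    refine ⟨z.re, h.spectrum_nonneg ?_, hz'⟩
    rw [hz'] at hz
    exact (spectrum.algebraMap_mem_iff ℂ (R := ℝ) (a := T)).1 hz
  have hcomp : ∀ z ∈ spectrum ℂ T, (fun w : ℂ => if w = 0 then 0 else ((f (w⁻¹).re : ℝ) : ℂ))
      (resolventFun c z) = (transfer c f z.re : ℝ) := fun z hz => by
    obtain ⟨t, ht, rfl⟩ := hspec z hz
    rw [Complex.ofReal_re]
    rcases eq_or_ne t 0 with rfl | ht0
    · simp [resolventFun, transfer]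
    · have hinv := resolventFun_ofReal_inv c ht0
      have hne : resolventFun c t ≠ 0 := by
        rw [resolventFun]
        exact mul_ne_zero (by exact_mod_cast ht0) (inv_ne_zero (one_sub_mul_ofReal_ne_zero c t))
      simp only [hne, if_false, hinv, transfer, ht0]
      simp
  have hcont : ContinuousOn (resolventFun c) (spectrum ℂ T) := by
    refine continuousOn_id.mul (ContinuousOn.inv₀ (by fun_prop) fun z hz => ?_)
    obtain ⟨t, ht, rfl⟩ := hspec z hz
    exact one_sub_mul_ofReal_ne_zero c t
  have hcont2 : ContinuousOn (fun w : ℂ => if w = 0 then 0 else ((f (w⁻¹).re : ℝ) : ℂ))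
      (resolventFun c '' spectrum ℂ T) := by
    rw [eventually_atTop] at h0
    obtain ⟨K, hK⟩ := h0
    intro w hw
    rcases eq_or_ne w 0 with rfl | hw0
    · have hev : ∀ᶠ w in 𝓝[resolventFun c '' spectrum ℂ T] (0 : ℂ),
          (if w = 0 then 0 else ((f (w⁻¹).re : ℝ) : ℂ)) = 0 := by
        rw [eventually_nhdsWithin_iff]
        -- If `‖w‖` is below this radius, then `|λ - i| > |K| + |c| + 1`, hence `|λ| > |K| + |c|`.
        -- As `λ ≥ -c`, the negative alternative is impossible, so `λ ≥ K` and `f` vanishes at `λ`.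
        have hpos : 0 < (|K| + |c| + 1)⁻¹ := by positivity
        filter_upwards [Metric.ball_mem_nhds (0 : ℂ) hpos] with w hwb hwi
        split_ifs with hw0
        · rfl
        obtain ⟨z, hz, rfl⟩ := hwi
        obtain ⟨t, ht, rfl⟩ := hspec z hz
        have ht0 : t ≠ 0 := by
          rintro rfl
          simp [resolventFun] at hw0
        have hinv := resolventFun_ofReal_inv c ht0
        rw [mem_ball_zero_iff] at hwb
        have h1 : |K| + |c| + 1 < ‖(resolventFun c t)⁻¹‖ := by
          rw [norm_inv]
          exact (lt_inv_comm₀ (norm_pos_iff.2 hw0) (by positivity)).1 hwb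
        have h2 : ‖(resolventFun c t)⁻¹‖ ≤ |t⁻¹ - c| + 1 := by
          rw [hinv]
          refine (norm_sub_le _ _).trans ?_
          rw [Complex.norm_real, Complex.norm_I, Real.norm_eq_abs]
        have h3 : 0 ≤ t⁻¹ := inv_nonneg.2 ht
        have h4 : K ≤ t⁻¹ - c := by
          rcases le_or_gt 0 (t⁻¹ - c) with h5 | h5
          · rw [abs_of_nonneg h5] at h2
            linarith [le_abs_self K, abs_nonneg c]
          · rw [abs_of_neg h5] at h2
            linarith [le_abs_self c, abs_nonneg K]
        rw [hinv]
        simp [hK _ h4]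
      rw [ContinuousWithinAt, if_pos rfl]
      exact tendsto_const_nhds.congr' (hev.mono fun _ h => h.symm)
    · have h1 : ContinuousAt (fun w : ℂ => ((f (w⁻¹).re : ℝ) : ℂ)) w :=
        Complex.continuous_ofReal.continuousAt.comp (hf.continuousAt.comp
          (Complex.continuous_re.continuousAt.comp (continuousAt_inv₀ hw0)))
      refine (h1.congr ?_).continuousWithinAt
      filter_upwards [isOpen_ne.mem_nhds hw0] with v hv
      rw [if_neg hv]
  rw [← cfc_comp _ _ T hn hcont2 hcont, cfc_real_eq_complex _ hsa]
  exact cfc_congr hcomp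

/-- The functions whose functional calculus is well behaved for operators bounded below: continuous
functions that vanish in a neighbourhood of `+∞`. -/
structure VanishesAtTop (f : ℝ → ℝ) : Prop where
  continuous : Continuous f
  eventually : ∀ᶠ t in atTop, f t = 0

namespace VanishesAtTop

variable {f g : ℝ → ℝ}

theorem of_hasCompactSupport (hf : Continuous f) (hc : HasCompactSupport f) : VanishesAtTop f := by
  refine ⟨hf, ?_⟩
  obtain ⟨b, hb⟩ := hc.isCompact.bddAbove
  filter_upwards [eventually_gt_atTop b] with t ht
  exact image_eq_zero_of_notMem_tsupport fun h => not_lt_of_ge (hb h) ht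

theorem mul_left (hg : Continuous g) (hf : VanishesAtTop f) :
    VanishesAtTop fun t => g t * f t :=
  ⟨hg.mul hf.continuous, hf.eventually.mono fun t ht => by rw [ht, mul_zero]⟩

theorem sub (hf : VanishesAtTop f) (hg : VanishesAtTop g) : VanishesAtTop fun t => f t - g t :=
  ⟨hf.continuous.sub hg.continuous, by
    filter_upwards [hf.eventually, hg.eventually] with t h1 h2
    rw [h1, h2, sub_zero]⟩

theorem comp {φ : ℝ → ℝ} (hφ : Continuous φ) (h0 : φ 0 = 0) (hf : VanishesAtTop f) :
    VanishesAtTop fun t => φ (f t) :=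
  ⟨hφ.comp hf.continuous, hf.eventually.mono fun t ht => by rw [ht, h0]⟩

end VanishesAtTop

/-- The span of the ranges of `f(A)` for `f` with compact support in `U`; it is dense in the
spectral subspace. -/
def spectralCore (A : 𝓗 →ₗ.[ℂ] 𝓗) (U : Set ℝ) : Submodule ℂ 𝓗 :=
  ⨆ f ∈ {f : ℝ → ℝ | Continuous f ∧ HasCompactSupport f ∧ tsupport f ⊆ U}, (funCalc A f).range

theorem spectralSubspace_eq (A : 𝓗 →ₗ.[ℂ] 𝓗) (U : Set ℝ) :
    spectralSubspace A U = (spectralCore A U).topologicalClosure := rfl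

theorem funCalc_mem_spectralCore (A : 𝓗 →ₗ.[ℂ] 𝓗) {U : Set ℝ} {f : ℝ → ℝ} (hf : Continuous f)
    (hc : HasCompactSupport f) (hU : tsupport f ⊆ U) (x : 𝓗) : funCalc A f x ∈ spectralCore A U :=
  Submodule.mem_iSup_of_mem f (Submodule.mem_iSup_of_mem ⟨hf, hc, hU⟩ ⟨x, rfl⟩)

theorem spectralCore_le (A : 𝓗 →ₗ.[ℂ] 𝓗) (U : Set ℝ) : spectralCore A U ≤ spectralSubspace A U :=
  Submodule.le_topologicalClosure _

instance (A : 𝓗 →ₗ.[ℂ] 𝓗) (U : Set ℝ) : CompleteSpace (spectralSubspace A U) :=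
  (Submodule.isClosed_topologicalClosure _).completeSpace_coe

/-- A continuous cutoff function that equals one on a compact set. -/
theorem exists_cutoff {C U : Set ℝ} (hC : IsCompact C) (hU : IsOpen U) (hCU : C ⊆ U) :
    ∃ f : ℝ → ℝ, Continuous f ∧ HasCompactSupport f ∧ tsupport f ⊆ U ∧ (∀ t ∈ C, f t = 1) ∧
      ∀ t, f t ∈ Set.Icc (0 : ℝ) 1 := by
  obtain ⟨V, hV, hCV, hVU, hVc⟩ := exists_open_between_and_isCompact_closure hC hU hCU
  obtain ⟨f, hf, h1, h01⟩ := exists_tsupport_one_of_isOpen_isClosed hV hVc hC.isClosed hCV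
  exact ⟨f, f.continuous, hVc.of_isClosed_subset (isClosed_tsupport _) (hf.trans subset_closure),
    hf.trans (subset_closure.trans hVU), h1, h01⟩

theorem re_inner_le_of_le_algebraMap {S : 𝓗 →L[ℂ] 𝓗} {r : ℝ}
    (hle : S ≤ algebraMap ℝ (𝓗 →L[ℂ] 𝓗) r) (x : 𝓗) : (⟪x, S x⟫_ℂ).re ≤ r * ‖x‖ ^ 2 := by
  have := ((ContinuousLinearMap.le_def _ _).1 hle).re_inner_nonneg_right x
  rw [sub_apply, inner_sub_right, map_sub, Algebra.algebraMap_eq_smul_one, smul_apply,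
    one_apply_eq_self, ← Complex.coe_smul, inner_smul_right, inner_self_eq_norm_sq_to_K] at this
  norm_cast at this
  simp at this
  norm_cast at this ⊢

namespace IsShiftedInverse

variable {A : 𝓗 →ₗ.[ℂ] 𝓗} {c : ℝ} {T : 𝓗 →L[ℂ] 𝓗} {f g : ℝ → ℝ}

theorem continuousOn_transfer (h : IsShiftedInverse A c T) (hf : VanishesAtTop f) :
    ContinuousOn (transfer c f) (spectrum ℝ T) :=
  (Schrodinger.continuousOn_transfer c hf.continuous hf.eventually).mono fun _ ht =>
    h.spectrum_nonneg ht

theorem funCalc_eq_cfc (h : IsShiftedInverse A c T) (hf : VanishesAtTop f) :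
    funCalc A f = cfc (transfer c f) T :=
  h.funCalc_eq hf.continuous hf.eventually

/-- The spectrum of `T` lies in `[0, ∞)`: a point `t > 0` corresponds to an energy above `-c`, and
`t = 0` to the value `0`. Pointwise bounds on `f` are thus needed only above `-c`. -/
theorem transfer_spec (h : IsShiftedInverse A c T) {p : ℝ → Prop} (h0 : p 0)
    (hp : ∀ t, -c < t → p (f t)) {t : ℝ} (ht : t ∈ spectrum ℝ T) : p (transfer c f t) := by
  rw [transfer]
  split_ifs with ht0
  · exact h0
  · have : 0 < t⁻¹ := inv_pos.2 (lt_of_le_of_ne (h.spectrum_nonneg ht) (Ne.symm ht0))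
    exact hp _ (by linarith)

theorem funCalc_congr (h : IsShiftedInverse A c T) (hf : VanishesAtTop f) (hg : VanishesAtTop g)
    (hfg : ∀ t, -c < t → f t = g t) : funCalc A f = funCalc A g := by
  rw [h.funCalc_eq_cfc hf, h.funCalc_eq_cfc hg]
  refine cfc_congr fun t ht => ?_
  simp only [transfer]
  split_ifs with ht0
  · rfl
  · have : 0 < t⁻¹ := inv_pos.2 (lt_of_le_of_ne (h.spectrum_nonneg ht) (Ne.symm ht0))
    exact hfg _ (by linarith)

theorem inner_funCalc_left (h : IsShiftedInverse A c T) (hf : VanishesAtTop f) (x y : 𝓗) :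
    ⟪funCalc A f x, y⟫_ℂ = ⟪x, funCalc A f y⟫_ℂ := by
  have hs : IsSelfAdjoint (funCalc A f) := by
    rw [h.funCalc_eq_cfc hf]
    exact cfc_predicate _ _
  have := ContinuousLinearMap.adjoint_inner_left (funCalc A f) y x
  rwa [← ContinuousLinearMap.star_eq_adjoint, hs.star_eq] at this

theorem funCalc_mul_apply (h : IsShiftedInverse A c T) (hf : VanishesAtTop f)
    (hg : VanishesAtTop g) (x : 𝓗) :
    funCalc A (fun t => f t * g t) x = funCalc A f (funCalc A g x) := by
  rw [h.funCalc_eq_cfc (hg.mul_left hf.continuous), h.funCalc_eq_cfc hf, h.funCalc_eq_cfc hg,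
    ← mul_apply_eq_comp, ← cfc_mul _ _ T (h.continuousOn_transfer hf) (h.continuousOn_transfer hg)]
  congr 2
  ext t
  simp only [transfer]
  split_ifs <;> simp

theorem funCalc_sub_apply (h : IsShiftedInverse A c T) (hf : VanishesAtTop f)
    (hg : VanishesAtTop g) (x : 𝓗) :
    funCalc A (fun t => f t - g t) x = funCalc A f x - funCalc A g x := by
  rw [h.funCalc_eq_cfc (hf.sub hg), h.funCalc_eq_cfc hf, h.funCalc_eq_cfc hg,
    ← sub_apply, ← cfc_sub _ _ T (h.continuousOn_transfer hf) (h.continuousOn_transfer hg)]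
  congr 2
  ext t
  simp only [transfer]
  split_ifs <;> simp

theorem funCalc_const_mul_apply (h : IsShiftedInverse A c T) (hf : VanishesAtTop f) (r : ℝ)
    (x : 𝓗) : funCalc A (fun t => r * f t) x = r • funCalc A f x := by
  rw [h.funCalc_eq_cfc (hf.mul_left continuous_const), h.funCalc_eq_cfc hf, ← smul_apply,
    ← cfc_smul r _ T (h.continuousOn_transfer hf)]
  congr 2
  ext t
  simp only [transfer, smul_eq_mul]
  split_ifs <;> simp

theorem funCalc_nonneg (h : IsShiftedInverse A c T) (hf : VanishesAtTop f)
    (h0 : ∀ t, -c < t → 0 ≤ f t) (x : 𝓗) : 0 ≤ (⟪x, funCalc A f x⟫_ℂ).re := by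
  have : 0 ≤ funCalc A f := by
    rw [h.funCalc_eq_cfc hf]
    exact cfc_nonneg fun t ht => h.transfer_spec (p := fun y => 0 ≤ y) le_rfl h0 ht
  exact ((ContinuousLinearMap.nonneg_iff_isPositive _).1 this).re_inner_nonneg_right x

theorem funCalc_mono (h : IsShiftedInverse A c T) (hf : VanishesAtTop f) (hg : VanishesAtTop g)
    (hfg : ∀ t, -c < t → f t ≤ g t) (x : 𝓗) :
    (⟪x, funCalc A f x⟫_ℂ).re ≤ (⟪x, funCalc A g x⟫_ℂ).re := by
  have := h.funCalc_nonneg (hg.sub hf) (fun t ht => sub_nonneg.2 (hfg t ht)) x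
  rw [h.funCalc_sub_apply hg hf, inner_sub_right, Complex.sub_re] at this
  linarith

theorem funCalc_le (h : IsShiftedInverse A c T) (hf : VanishesAtTop f) {r : ℝ} (hr : 0 ≤ r)
    (hfr : ∀ t, -c < t → f t ≤ r) (x : 𝓗) : (⟪x, funCalc A f x⟫_ℂ).re ≤ r * ‖x‖ ^ 2 := by
  have hle : funCalc A f ≤ algebraMap ℝ (𝓗 →L[ℂ] 𝓗) r := by
    rw [h.funCalc_eq_cfc hf]
    exact cfc_le_algebraMap _ r T (fun t ht => h.transfer_spec (p := fun y => y ≤ r) hr hfr ht)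
      (h.continuousOn_transfer hf) h.isSelfAdjoint
  exact re_inner_le_of_le_algebraMap hle x

/-- `f(A) = T ((A + c) f)(A)`. -/
theorem apply_funCalc_shift (h : IsShiftedInverse A c T) (hf : VanishesAtTop f) (x : 𝓗) :
    T (funCalc A (fun t => (t + c) * f t) x) = funCalc A f x := by
  have hg : VanishesAtTop fun t => (t + c) * f t := hf.mul_left (by fun_prop)
  rw [h.funCalc_eq_cfc hg, h.funCalc_eq_cfc hf]
  have e : cfc (transfer c f) T = T * cfc (transfer c fun t => (t + c) * f t) T := by
    have := cfc_mul (fun t : ℝ => t) (transfer c fun t => (t + c) * f t) T (by fun_prop)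
      (h.continuousOn_transfer hg)
    rw [cfc_id' ℝ T h.isSelfAdjoint] at this
    rw [← this]
    refine cfc_congr fun t _ => ?_
    simp only [transfer]
    split_ifs with ht0
    · simp
    · field_simp
      ring_nf
  rw [e, mul_apply_eq_comp]

/-- A vector in the kernel of a spectral cutoff at energies below `σ` satisfies the bound
`T ≤ (σ + c)⁻¹`. -/
theorem inner_apply_le_of_funCalc_eq_zero (h : IsShiftedInverse A c T) (hf : VanishesAtTop f)
    (h01 : ∀ t, f t ∈ Set.Icc (0 : ℝ) 1) {σ : ℝ} (hσ : 0 < σ + c)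
    (h1 : ∀ t ∈ Set.Icc (-c) σ, f t = 1) {x : 𝓗} (hx : funCalc A f x = 0) :
    (⟪x, T x⟫_ℂ).re ≤ (σ + c)⁻¹ * ‖x‖ ^ 2 := by
  have hcf := h.continuousOn_transfer hf
  have hsa := h.isSelfAdjoint
  -- `S = T (1 - f(A))` has the same quadratic form at `x` as `T`, because `f(A) x = 0`. It is at
  -- most `(σ + c)⁻¹`: the factor `1 - f` vanishes on energies in `[-c, σ]`, while higher energies
  -- have `t < (σ + c)⁻¹`.
  set S : 𝓗 →L[ℂ] 𝓗 := cfc (fun t => t * (1 - transfer c f t)) T with hS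
  have hST : S = T - T * funCalc A f := by
    rw [hS, h.funCalc_eq_cfc hf]
    have e1 := cfc_mul (fun t : ℝ => t) (transfer c f) T (by fun_prop) hcf
    rw [cfc_id' ℝ T hsa] at e1
    have e2 := cfc_sub (fun t : ℝ => t) (fun t => t * transfer c f t) T (by fun_prop)
      (by fun_prop)
    rw [cfc_id' ℝ T hsa, e1] at e2
    rw [← e2]
    congr 1
    ext t
    ring
  have hle : S ≤ algebraMap ℝ (𝓗 →L[ℂ] 𝓗) (σ + c)⁻¹ := by
    refine cfc_le_algebraMap _ _ T (fun t ht => ?_) (by fun_prop) hsa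
    have ht0 := h.spectrum_nonneg ht
    rcases eq_or_lt_of_le ht0 with rfl | htpos
    · rw [zero_mul]; positivity
    · rw [transfer, if_neg htpos.ne']
      have hti : 0 < t⁻¹ := inv_pos.2 htpos
      rcases le_or_gt (t⁻¹ - c) σ with hle | hgt
      · rw [h1 _ ⟨by linarith, hle⟩]
        simp only [sub_self, mul_zero]
        positivity
      · have htb : t ≤ (σ + c)⁻¹ := by
          rw [le_inv_comm₀ htpos hσ]
          linarith
        have := (h01 (t⁻¹ - c)).1
        nlinarith
  have := re_inner_le_of_le_algebraMap hle x
  rwa [hST, sub_apply, mul_apply_eq_comp, hx, map_zero, sub_zero] at this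

end IsShiftedInverse

/-! ### Form bounds on spectral subspaces and their comparison for two operators. -/

namespace IsShiftedInverse

section FormSpace

variable {K : Type*} [NormedAddCommGroup K] [InnerProductSpace ℂ K] [CompleteSpace K]
  {A : 𝓗 →ₗ.[ℂ] 𝓗} {c : ℝ} {j : K →L[ℂ] 𝓗}

theorem norm_adjoint_sq (j : K →L[ℂ] 𝓗) (x : 𝓗) :
    ‖ContinuousLinearMap.adjoint j x‖ ^ 2 =
      (⟪x, (j ∘L ContinuousLinearMap.adjoint j) x⟫_ℂ).re := by
  rw [ContinuousLinearMap.comp_apply, ← ContinuousLinearMap.adjoint_inner_left]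
  exact norm_sq_eq_re_inner (𝕜 := ℂ) _

/-- For `w = j k` without spectral part below `s`, `‖j* w‖² = ⟨w, T w⟩` is at most `‖w‖² / r` for
every positive `r < s + c`, and `‖w‖² = ⟨j* w, k⟩ ≤ ‖j* w‖ ‖k‖`. Together these give `r ‖w‖² ≤
‖k‖²`. This reaches every `k` in the form space, not only vectors in the operator domain. -/
theorem le_norm_sq_of_funCalc_eq_zero
    (h : IsShiftedInverse A c (j ∘L ContinuousLinearMap.adjoint j)) {s : ℝ} {k : K}
    (hk : ∀ f : ℝ → ℝ, Continuous f → HasCompactSupport f → tsupport f ⊆ Set.Iio s →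
      funCalc A f (j k) = 0) : (s + c) * ‖j k‖ ^ 2 ≤ ‖k‖ ^ 2 := by
  by_contra! hlt
  have hw : 0 < ‖j k‖ ^ 2 := by
    rcases (sq_nonneg ‖j k‖).eq_or_lt with h0 | h0
    · rw [← h0, mul_zero] at hlt
      exact absurd hlt (not_lt_of_ge (sq_nonneg _))
    · exact h0
  have hq : ‖k‖ ^ 2 / ‖j k‖ ^ 2 < s + c := (div_lt_iff₀ hw).2 hlt
  -- The gap between `r` and `s + c` leaves room for a cutoff that is one on `[-c, r - c]` and still
  -- supported below `s`.
  obtain ⟨r, hr1, hr2⟩ := exists_between hq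
  have hr0 : 0 < r := lt_of_le_of_lt (by positivity) hr1
  obtain ⟨f, hf, hfc, hfs, hf1, hf01⟩ := exists_cutoff (isCompact_Icc (a := -c) (b := r - c))
    (isOpen_Iio (a := s)) fun t ht => by
      have := ht.2
      rw [Set.mem_Iio]
      linarith
  have hb := h.inner_apply_le_of_funCalc_eq_zero (.of_hasCompactSupport hf hfc) hf01
    (σ := r - c) (by linarith) hf1 (hk f hf hfc hfs)
  rw [← norm_adjoint_sq, sub_add_cancel] at hb
  have h1 : ‖j k‖ ^ 2 ≤ ‖ContinuousLinearMap.adjoint j (j k)‖ * ‖k‖ := by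
    rw [norm_sq_eq_re_inner (𝕜 := ℂ), ← ContinuousLinearMap.adjoint_inner_left]
    exact re_inner_le_norm _ _
  have h2 : (‖j k‖ ^ 2) ^ 2 ≤ r⁻¹ * ‖j k‖ ^ 2 * ‖k‖ ^ 2 := by
    calc (‖j k‖ ^ 2) ^ 2 ≤ (‖ContinuousLinearMap.adjoint j (j k)‖ * ‖k‖) ^ 2 := by gcongr
      _ = ‖ContinuousLinearMap.adjoint j (j k)‖ ^ 2 * ‖k‖ ^ 2 := mul_pow _ _ _
      _ ≤ _ := by gcongr
  have h3 : ‖j k‖ ^ 2 ≤ r⁻¹ * ‖k‖ ^ 2 := by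
    refine le_of_mul_le_mul_left ?_ hw
    linarith
  rw [div_lt_iff₀ hw] at hr1
  rw [inv_mul_eq_div, le_div_iff₀ hr0] at h3
  linarith

/-- Core vectors are finite sums of vectors `f(A) z`, so the compact set is a finite union of
supports. This gives core vectors a margin from the boundary of `U`, which vectors in the closure
may lack. -/
theorem exists_isCompact_funCalc_eq_self {T : 𝓗 →L[ℂ] 𝓗} (h : IsShiftedInverse A c T)
    {U : Set ℝ} {u : 𝓗} (hu : u ∈ spectralCore A U) :
    ∃ C : Set ℝ, IsCompact C ∧ C ⊆ U ∧ ∀ g : ℝ → ℝ, VanishesAtTop g → (∀ t ∈ C, g t = 1) →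
      funCalc A g u = u := by
  let P : 𝓗 → Prop := fun u => ∃ C : Set ℝ, IsCompact C ∧ C ⊆ U ∧ ∀ g : ℝ → ℝ,
    VanishesAtTop g → (∀ t ∈ C, g t = 1) → funCalc A g u = u
  refine Submodule.iSup_induction _ (motive := P) hu (fun f x hx => ?_)
    ⟨∅, isCompact_empty, Set.empty_subset _, fun g _ _ => map_zero _⟩ ?_
  · refine Submodule.iSup_induction _ (motive := P) hx (fun hf y hy => ?_)
      ⟨∅, isCompact_empty, Set.empty_subset _, fun g _ _ => map_zero _⟩ ?_
    · obtain ⟨hfc, hfs, hfU⟩ := hf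
      obtain ⟨z, rfl⟩ := hy
      refine ⟨tsupport f, hfs, hfU, fun g hg h1 => ?_⟩
      have hfv := VanishesAtTop.of_hasCompactSupport hfc hfs
      have e := h.funCalc_mul_apply hg hfv z
      have : (fun t => g t * f t) = f := by
        ext t
        by_cases ht : t ∈ tsupport f
        · rw [h1 t ht, one_mul]
        · rw [image_eq_zero_of_notMem_tsupport ht, mul_zero]
      rw [this] at e
      exact e.symm
    · rintro x y ⟨C, hC, hCU, h1⟩ ⟨D, hD, hDU, h2⟩
      refine ⟨C ∪ D, hC.union hD, Set.union_subset hCU hDU, fun g hg h => ?_⟩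
      rw [map_add, h1 g hg fun t ht => h t (Or.inl ht), h2 g hg fun t ht => h t (Or.inr ht)]
  · rintro x y ⟨C, hC, hCU, h1⟩ ⟨D, hD, hDU, h2⟩
    refine ⟨C ∪ D, hC.union hD, Set.union_subset hCU hDU, fun g hg h => ?_⟩
    rw [map_add, h1 g hg fun t ht => h t (Or.inl ht), h2 g hg fun t ht => h t (Or.inr ht)]

/-- The preimage is `k = j* (A + c) g(A) u` with `g(A) u = u`, so that `‖k‖² = ⟨u, (A + c) g(A) u⟩`.
The support of `g` lies below some `r < s`, whence the bound `(r + c) ‖u‖²` and strictness. -/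
theorem exists_norm_sq_lt_of_mem_spectralCore
    (h : IsShiftedInverse A c (j ∘L ContinuousLinearMap.adjoint j)) {s : ℝ} {u : 𝓗}
    (hu : u ∈ spectralCore A (Set.Iio s)) (hu0 : u ≠ 0) :
    ∃ k, j k = u ∧ ‖k‖ ^ 2 < (s + c) * ‖u‖ ^ 2 := by
  obtain ⟨C, hC, hCs, h1⟩ := h.exists_isCompact_funCalc_eq_self hu
  obtain ⟨r, hrs, hCr⟩ : ∃ r < s, C ⊆ Set.Iio r := by
    rcases C.eq_empty_or_nonempty with rfl | hne
    · exact ⟨s - 1, by linarith, Set.empty_subset _⟩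
    · obtain ⟨m, hm, hmax⟩ := hC.exists_isGreatest hne
      obtain ⟨r, hr1, hr2⟩ := exists_between (Set.mem_Iio.1 (hCs hm))
      exact ⟨r, hr2, fun t ht => lt_of_le_of_lt (hmax ht) hr1⟩
  obtain ⟨g, hg, hgc, hgs, hg1, hg01⟩ := exists_cutoff hC isOpen_Iio hCr
  have hgv := VanishesAtTop.of_hasCompactSupport hg hgc
  have hgu := h1 g hgv hg1
  have hsv : VanishesAtTop fun t => (t + c) * g t := hgv.mul_left (by fun_prop)
  have hT := h.apply_funCalc_shift hgv u
  rw [hgu] at hT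
  refine ⟨ContinuousLinearMap.adjoint j (funCalc A (fun t => (t + c) * g t) u), hT, ?_⟩
  rw [norm_adjoint_sq, hT, h.inner_funCalc_left hsv]
  have hle := h.funCalc_mono hsv (hgv.mul_left (continuous_const (y := r + c))) (fun t _ => by
    rcases lt_or_ge t r with htr | htr
    · have := (hg01 t).1
      gcongr
    · rw [image_eq_zero_of_notMem_tsupport fun ht => absurd (hgs ht) (not_lt_of_ge htr), mul_zero,
        mul_zero]) u
  rw [h.funCalc_const_mul_apply hgv, hgu, ← Complex.coe_smul, inner_smul_right,
    inner_self_eq_norm_sq_to_K] at hle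
  have hpos : 0 < ‖u‖ ^ 2 := by positivity
  have he : ((r + c : ℝ) * ((‖u‖ : ℂ)) ^ 2 : ℂ).re = (r + c) * ‖u‖ ^ 2 := by
    norm_cast
  calc _ ≤ _ := hle
    _ = (r + c) * ‖u‖ ^ 2 := he
    _ < _ := by gcongr

end FormSpace

/-- If the form of `A` dominates `κ` times the form of `B`, then spectral subspaces of `A` below
`κ s` are at most as large as those of `B` below `s`. -/
theorem rank_spectralSubspace_le {K₁ K₂ : Type*} [NormedAddCommGroup K₁] [InnerProductSpace ℂ K₁]
    [CompleteSpace K₁] [NormedAddCommGroup K₂] [InnerProductSpace ℂ K₂] [CompleteSpace K₂]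
    {A B : 𝓗 →ₗ.[ℂ] 𝓗} {c₁ c₂ κ : ℝ} {j₁ : K₁ →L[ℂ] 𝓗} {j₂ : K₂ →L[ℂ] 𝓗}
    (hA : IsShiftedInverse A c₁ (j₁ ∘L ContinuousLinearMap.adjoint j₁))
    (hB : IsShiftedInverse B c₂ (j₂ ∘L ContinuousLinearMap.adjoint j₂)) (hκ : 0 < κ)
    (hcmp : ∀ k₁, ∃ k₂, j₂ k₂ = j₁ k₁ ∧
      κ * (‖k₂‖ ^ 2 - c₂ * ‖j₁ k₁‖ ^ 2) ≤ ‖k₁‖ ^ 2 - c₁ * ‖j₁ k₁‖ ^ 2) (s : ℝ) :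
    Cardinal.toENat (Module.rank ℂ (spectralSubspace A (Set.Iio (κ * s)))) ≤
      Cardinal.toENat (Module.rank ℂ (spectralSubspace B (Set.Iio s))) := by
  set N := spectralSubspace B (Set.Iio s) with hN
  -- The projection onto `N` is injective on the core: a nonzero vector in its kernel would have
  -- `A`-form strictly below `κ s ‖u‖²`, yet `B`-form at least `s ‖u‖²`. The core is used in place
  -- of its closure because it provides the strict inequality.
  have hinj : Function.Injective
      ((N.orthogonalProjectionOnto : 𝓗 →ₗ[ℂ] N) ∘ₗ (spectralCore A (Set.Iio (κ * s))).subtype) := by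
    rw [← LinearMap.ker_eq_bot, LinearMap.ker_eq_bot']
    rintro ⟨u, hu⟩ hu0
    by_contra hne
    have hu0' : N.orthogonalProjectionOnto u = 0 := hu0
    have hune : u ≠ 0 := fun h => hne (Subtype.ext h)
    obtain ⟨k₁, rfl, hk₁⟩ := hA.exists_norm_sq_lt_of_mem_spectralCore hu hune
    obtain ⟨k₂, hk, hcmp⟩ := hcmp k₁
    have horth : ∀ x ∈ N, ⟪x, j₁ k₁⟫_ℂ = 0 := by
      have := Submodule.orthogonalProjectionOnto_eq_zero_iff.1 hu0'
      exact (Submodule.mem_orthogonal _ _).1 this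
    have hk₂ := hB.le_norm_sq_of_funCalc_eq_zero (s := s) (k := k₂) fun f hf hfc hfs => by
      refine ext_inner_left ℂ fun x => ?_
      rw [← hB.inner_funCalc_left (.of_hasCompactSupport hf hfc), hk, inner_zero_right]
      exact horth _ (spectralCore_le _ _ (funCalc_mem_spectralCore B hf hfc hfs x))
    rw [hk] at hk₂
    nlinarith
  have hrank := LinearMap.rank_le_of_injective _ hinj
  -- If `N` is finite-dimensional, so is the core, which is then closed and equal to the spectral
  -- subspace. Otherwise the right side is `⊤`.
  rcases lt_or_ge (Module.rank ℂ N) Cardinal.aleph0 with hfin | hinf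
  · have : Module.Finite ℂ (spectralCore A (Set.Iio (κ * s))) :=
      Module.rank_lt_aleph0_iff.1 (hrank.trans_lt hfin)
    rw [spectralSubspace_eq, (Submodule.closed_of_finiteDimensional _).submodule_topologicalClosure_eq]
    exact OrderHomClass.mono _ hrank
  · rw [Cardinal.toENat_eq_top.2 hinf]
    exact le_top

end IsShiftedInverse

/-! ### Dimensions and traces as sums over orthonormal bases. -/

theorem ofReal_norm_sq_eq_tsum {E ι : Type*} [NormedAddCommGroup E] [InnerProductSpace ℂ E]
    (e : HilbertBasis ι ℂ E) (x : E) :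
    ENNReal.ofReal (‖x‖ ^ 2) = ∑' i, ENNReal.ofReal (‖⟪e i, x⟫_ℂ‖ ^ 2) := by
  have hs : HasSum (fun i => ‖⟪e i, x⟫_ℂ‖ ^ 2) (‖x‖ ^ 2) := by
    have h2 := Complex.hasSum_re (e.hasSum_inner_mul_inner x x)
    rw [show (⟪x, x⟫_ℂ).re = ‖x‖ ^ 2 from (norm_sq_eq_re_inner (𝕜 := ℂ) x).symm] at h2
    refine h2.congr_fun fun i => ?_
    rw [← inner_conj_symm, Complex.mul_conj, Complex.ofReal_re, Complex.normSq_eq_norm_sq,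
      RCLike.norm_conj]
  rw [← hs.tsum_eq, ENNReal.ofReal_tsum_of_nonneg (fun _ => by positivity) hs.summable]

theorem toENat_rank_eq_card {E ι : Type*} [NormedAddCommGroup E] [InnerProductSpace ℂ E]
    (e : HilbertBasis ι ℂ E) : Cardinal.toENat (Module.rank ℂ E) = ENat.card ι := by
  rcases finite_or_infinite ι with hfin | hinf
  · have := Fintype.ofFinite ι
    have hr := rank_eq_card_basis e.toOrthonormalBasis.toBasis
    rw [hr]
    simp
  · rw [ENat.card_eq_top_of_infinite, Cardinal.toENat_eq_top]
    have h1 := e.orthonormal.linearIndependent.aleph0_le_rank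
    exact h1

/-- The dimension of a closed subspace is the trace of the projection onto it. -/
theorem tsum_norm_starProjection_sq {ι : Type*} (b : HilbertBasis ι ℂ 𝓗) (M : Submodule ℂ 𝓗)
    [CompleteSpace M] : ∑' i, ENNReal.ofReal (‖M.starProjection (b i)‖ ^ 2) =
      (Cardinal.toENat (Module.rank ℂ M) : ℝ≥0∞) := by
  obtain ⟨J, e, -⟩ := exists_hilbertBasis ℂ M
  have h1 : ∀ i, ENNReal.ofReal (‖M.starProjection (b i)‖ ^ 2) =
      ∑' k, ENNReal.ofReal (‖⟪b i, (e k : 𝓗)⟫_ℂ‖ ^ 2) := fun i => by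
    rw [Submodule.starProjection_apply, ← Submodule.coe_norm, ofReal_norm_sq_eq_tsum e]
    refine tsum_congr fun k => ?_
    rw [Submodule.inner_orthogonalProjectionOnto_eq_of_mem_left, norm_inner_symm]
  simp_rw [h1]
  rw [ENNReal.tsum_comm, toENat_rank_eq_card e, ← ENNReal.tsum_one]
  refine tsum_congr fun k => ?_
  rw [← ofReal_norm_sq_eq_tsum b, ← Submodule.coe_norm, e.orthonormal.1 k]
  simp

/-- The dimension of the spectral subspace of `A` for the open set `U`. -/
def spectralDim (A : 𝓗 →ₗ.[ℂ] 𝓗) (U : Set ℝ) : ℕ∞ :=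
  Cardinal.toENat (Module.rank ℂ (spectralSubspace A U))

theorem traceOp_mono {S S' : 𝓗 →L[ℂ] 𝓗}
    (h : ∀ x, (⟪x, S x⟫_ℂ).re ≤ (⟪x, S' x⟫_ℂ).re) : traceOp S ≤ traceOp S' :=
  ENNReal.tsum_le_tsum fun _ => ENNReal.ofReal_le_ofReal (h _)

/-- The sum of the squared norms of the projections onto `M` of the basis vectors used in the
definition of the trace. -/
theorem tsum_traceBasis (M : Submodule ℂ 𝓗) [CompleteSpace M] {η : ℝ} (hη : 0 ≤ η) :
    ∑' i, ENNReal.ofReal (η * ‖M.starProjection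
      ((exists_hilbertBasis ℂ 𝓗).choose_spec.choose i)‖ ^ 2) =
      ENNReal.ofReal η * (Cardinal.toENat (Module.rank ℂ M) : ℝ≥0∞) := by
  rw [← tsum_norm_starProjection_sq (exists_hilbertBasis ℂ 𝓗).choose_spec.choose M,
    ← ENNReal.tsum_mul_left]
  exact tsum_congr fun i => ENNReal.ofReal_mul hη

/-! ### Trace inequalities from dimension inequalities. -/

namespace IsShiftedInverse

variable {A B : 𝓗 →ₗ.[ℂ] 𝓗} {c c' : ℝ} {T T' : 𝓗 →L[ℂ] 𝓗} {f g : ℝ → ℝ}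

/-- The support of `f` may extend to `-∞`, whereas the spectral subspace is built from compactly
supported functions. Only energies above `-c` matter, so `f` may be multiplied by a cutoff equal to
one on the part of its support in `[-c, b]`. -/
theorem funCalc_mem_spectralSubspace (h : IsShiftedInverse A c T) {U : Set ℝ} (hU : IsOpen U)
    (hf : VanishesAtTop f) (hfU : tsupport f ⊆ U) (x : 𝓗) :
    funCalc A f x ∈ spectralSubspace A U := by
  obtain ⟨b, hb⟩ := eventually_atTop.1 hf.eventually
  obtain ⟨g, hg, hgc, hgU, hg1, hg01⟩ := exists_cutoff
    ((isCompact_Icc (a := -c) (b := b)).inter_right (isClosed_tsupport f)) hU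
    (Set.inter_subset_right.trans hfU)
  have hgv := VanishesAtTop.of_hasCompactSupport hg hgc
  have e : funCalc A f = funCalc A fun t => f t * g t := by
    refine h.funCalc_congr hf (hgv.mul_left hf.continuous) fun t ht => ?_
    by_cases hts : t ∈ tsupport f
    · rcases le_or_gt b t with hbt | hbt
      · rw [hb t hbt, zero_mul]
      · rw [hg1 t ⟨⟨ht.le, hbt.le⟩, hts⟩, mul_one]
    · rw [image_eq_zero_of_notMem_tsupport hts, zero_mul]
  rw [e]
  exact spectralCore_le _ _ (funCalc_mem_spectralCore A (hf.continuous.mul hg) hgc.mul_left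
    ((tsupport_mul_subset_right).trans hgU) x)

/-- With `P` the projection onto the spectral subspace, `f(A) = P f(A) P ≤ η P`, and the trace of
`P` is the dimension. -/
theorem traceOp_funCalc_le (h : IsShiftedInverse A c T) {U : Set ℝ} (hU : IsOpen U)
    (hf : VanishesAtTop f) (hfU : tsupport f ⊆ U) {η : ℝ} (hη : 0 ≤ η) (hfη : ∀ t, f t ≤ η) :
    traceOp (funCalc A f) ≤ ENNReal.ofReal η * (spectralDim A U : ℝ≥0∞) := by
  rw [spectralDim, ← tsum_traceBasis _ hη, traceOp]
  refine ENNReal.tsum_le_tsum fun i => ENNReal.ofReal_le_ofReal ?_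
  set x := (exists_hilbertBasis ℂ 𝓗).choose_spec.choose i
  set M := spectralSubspace A U
  have hM : ∀ y, M.starProjection (funCalc A f y) = funCalc A f y := fun y =>
    Submodule.starProjection_eq_self_iff.2 (h.funCalc_mem_spectralSubspace hU hf hfU y)
  have e : ⟪x, funCalc A f x⟫_ℂ = ⟪M.starProjection x, funCalc A f (M.starProjection x)⟫_ℂ := by
    rw [← hM x, ← Submodule.inner_starProjection_left_eq_right, ← h.inner_funCalc_left hf,
      ← hM (M.starProjection x), ← Submodule.inner_starProjection_left_eq_right,
      ← h.inner_funCalc_left hf]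
    rw [Submodule.starProjection_eq_self_iff.2 (Submodule.starProjection_apply_mem _ _),
      ← hM (M.starProjection x), Submodule.inner_starProjection_left_eq_right]
  rw [e]
  exact h.funCalc_le hf hη (fun t _ => hfη t) _

/-- The kernel of `f(A) - η` is closed and contains the range of each `g(A)` with `g` supported in
`U`, since `f g = η g`. -/
theorem funCalc_apply_of_mem (h : IsShiftedInverse A c T) {U : Set ℝ} (hf : VanishesAtTop f)
    {η : ℝ} (hfη : ∀ t ∈ U, f t = η) {x : 𝓗} (hx : x ∈ spectralSubspace A U) :
    funCalc A f x = η • x := by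
  have hle : spectralSubspace A U ≤
      ((funCalc A f - (η : ℂ) • ContinuousLinearMap.id ℂ 𝓗).ker : Submodule ℂ 𝓗) := by
    refine Submodule.topologicalClosure_minimal _ ?_ (ContinuousLinearMap.isClosed_ker _)
    refine iSup₂_le fun g hg => ?_
    rintro _ ⟨y, rfl⟩
    have hgv := VanishesAtTop.of_hasCompactSupport hg.1 hg.2.1
    have e : (fun t => f t * g t) = fun t => η * g t := by
      ext t
      by_cases ht : t ∈ tsupport g
      · rw [hfη t (hg.2.2 ht)]
      · rw [image_eq_zero_of_notMem_tsupport ht, mul_zero, mul_zero]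
    have h1 := h.funCalc_mul_apply hf hgv y
    rw [e, h.funCalc_const_mul_apply hgv] at h1
    rw [LinearMap.mem_ker]
    change funCalc A f (funCalc A g y) - (η : ℂ) • funCalc A g y = 0
    rw [← h1, Complex.coe_smul, sub_self]
  have := hle hx
  rw [LinearMap.mem_ker] at this
  have h2 : funCalc A f x - (η : ℂ) • x = 0 := this
  rw [sub_eq_zero.1 h2, Complex.coe_smul]

/-- On the spectral subspace `f(A)` is the scalar `η`. The cross terms with the orthogonal
complement vanish, and the contribution of the complement is nonnegative, so `f(A) ≥ η P`. -/
theorem le_traceOp_funCalc (h : IsShiftedInverse A c T) {U : Set ℝ}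
    (hf : VanishesAtTop f) (hf0 : ∀ t, 0 ≤ f t) {η : ℝ} (hη : 0 ≤ η) (hfη : ∀ t ∈ U, f t = η) :
    ENNReal.ofReal η * (spectralDim A U : ℝ≥0∞) ≤ traceOp (funCalc A f) := by
  rw [spectralDim, ← tsum_traceBasis _ hη, traceOp]
  refine ENNReal.tsum_le_tsum fun i => ENNReal.ofReal_le_ofReal ?_
  set x := (exists_hilbertBasis ℂ 𝓗).choose_spec.choose i
  set M := spectralSubspace A U
  have hmem : M.starProjection x ∈ M := Submodule.starProjection_apply_mem _ _
  have hM := h.funCalc_apply_of_mem hf hfη hmem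
  set y := x - M.starProjection x with hy
  have hyM : ⟪M.starProjection x, y⟫_ℂ = 0 :=
    (Submodule.mem_orthogonal _ _).1 (Submodule.sub_starProjection_mem_orthogonal x) _ hmem
  have hyM' : ⟪y, M.starProjection x⟫_ℂ = 0 := by
    rw [← inner_conj_symm, hyM, map_zero]
  have hx : x = M.starProjection x + y := by rw [hy]; abel
  have e : ⟪x, funCalc A f x⟫_ℂ = η * (‖M.starProjection x‖ : ℂ) ^ 2 + ⟪y, funCalc A f y⟫_ℂ := by
    conv_lhs => rw [hx]
    rw [map_add, inner_add_left, inner_add_right, inner_add_right, hM,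
      ← h.inner_funCalc_left hf (M.starProjection x) y, hM, ← Complex.coe_smul, inner_smul_right,
      inner_smul_left, inner_smul_right, hyM, hyM', inner_self_eq_norm_sq_to_K]
    simp
  rw [e, Complex.add_re]
  have h1 : (η * (‖M.starProjection x‖ : ℂ) ^ 2 : ℂ).re = η * ‖M.starProjection x‖ ^ 2 := by
    norm_cast
  rw [h1]
  linarith [h.funCalc_nonneg hf (fun t _ => hf0 t) y]

theorem traceOp_funCalc_add (h : IsShiftedInverse A c T) (hf : VanishesAtTop f)
    (hg : VanishesAtTop g) (hf0 : ∀ t, 0 ≤ f t) (hg0 : ∀ t, 0 ≤ g t) :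
    traceOp (funCalc A fun t => f t + g t) = traceOp (funCalc A f) + traceOp (funCalc A g) := by
  have hfg : VanishesAtTop fun t => f t + g t := ⟨hf.continuous.add hg.continuous, by
    filter_upwards [hf.eventually, hg.eventually] with t h1 h2
    rw [h1, h2, add_zero]⟩
  rw [traceOp, traceOp, traceOp, ← ENNReal.tsum_add]
  refine tsum_congr fun i => ?_
  rw [← ENNReal.ofReal_add (h.funCalc_nonneg hf (fun t _ => hf0 t) _)
    (h.funCalc_nonneg hg (fun t _ => hg0 t) _), ← Complex.add_re, ← inner_add_right]
  have := h.funCalc_sub_apply hfg hg ((exists_hilbertBasis ℂ 𝓗).choose_spec.choose i)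
  simp only [add_sub_cancel_right] at this
  rw [this, sub_add_cancel]

theorem traceOp_const_mul (h : IsShiftedInverse A c T) (hf : VanishesAtTop f) {r : ℝ}
    (hr : 0 ≤ r) :
    traceOp (funCalc A fun t => r * f t) = ENNReal.ofReal r * traceOp (funCalc A f) := by
  rw [traceOp, traceOp, ← ENNReal.tsum_mul_left]
  refine tsum_congr fun i => ?_
  rw [h.funCalc_const_mul_apply hf, ← Complex.coe_smul, inner_smul_right, Complex.re_ofReal_mul,
    ENNReal.ofReal_mul hr]

/-- The part of `y` between the heights `a` and `a + ε`. -/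
def slice (a ε y : ℝ) : ℝ := min (max (y - a) 0) ε

theorem continuous_slice (a ε : ℝ) : Continuous (slice a ε) := by
  unfold slice
  fun_prop

theorem slice_zero {a ε : ℝ} (ha : 0 ≤ a) (hε : 0 ≤ ε) : slice a ε 0 = 0 := by
  rw [slice, max_eq_right (by linarith), min_eq_left hε]

theorem slice_nonneg {a ε : ℝ} (hε : 0 ≤ ε) (y : ℝ) : 0 ≤ slice a ε y :=
  le_min (le_max_right _ _) hε

theorem min_add_slice {a ε : ℝ} (hε : 0 ≤ ε) (y : ℝ) :
    min y (a + ε) = min y a + slice a ε y := by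
  rw [slice]
  rcases le_total y a with h1 | h1
  · rw [max_eq_right (by linarith), min_eq_left h1, min_eq_left (by linarith), min_eq_left hε,
      add_zero]
  · rw [max_eq_left (by linarith), min_eq_right h1]
    rcases le_total y (a + ε) with h2 | h2
    · rw [min_eq_left h2, min_eq_left (by linarith)]
      ring
    · rw [min_eq_right h2, min_eq_right (by linarith)]

/-- Both traces are compared with `ε` times a dimension at the intermediate level `a + ε`. The slice
of `f` has height at most `ε` and closed support in `{f ≥ a + 2ε}`, inside the open set `{f > a +
ε}`; the slice of `g` equals `ε` on `{g > a + ε}`. The shift by `2 * ε` makes room for these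
inclusions. -/
theorem traceOp_slice_le (hA : IsShiftedInverse A c T) (hB : IsShiftedInverse B c' T')
    (hf : VanishesAtTop f) (hg : VanishesAtTop g)
    (hdim : ∀ θ > 0, spectralDim A {t | θ < f t} ≤ spectralDim B {t | θ < g t})
    {a ε : ℝ} (ha : 0 ≤ a) (hε : 0 < ε) :
    traceOp (funCalc A fun t => slice (a + 2 * ε) ε (f t)) ≤
      traceOp (funCalc B fun t => slice a ε (g t)) := by
  have hsub : tsupport (fun t => slice (a + 2 * ε) ε (f t)) ⊆ {t | a + ε < f t} := by
    have h1 : tsupport (fun t => slice (a + 2 * ε) ε (f t)) ⊆ {t | a + 2 * ε ≤ f t} := by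
      refine closure_minimal (fun t ht => ?_) (isClosed_le continuous_const hf.continuous)
      by_contra hlt
      refine ht ?_
      have : f t < a + 2 * ε := not_le.1 hlt
      simp only [slice]
      rw [max_eq_right (by linarith), min_eq_left hε.le]
    refine h1.trans fun t ht => ?_
    have : a + 2 * ε ≤ f t := ht
    change a + ε < f t
    linarith
  calc _ ≤ ENNReal.ofReal ε * (spectralDim A {t | a + ε < f t} : ℝ≥0∞) :=
        hA.traceOp_funCalc_le (isOpen_lt continuous_const hf.continuous)
          (.comp (continuous_slice _ _) (slice_zero (by linarith) hε.le) hf) hsub hε.le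
          fun t => min_le_right _ _
    _ ≤ ENNReal.ofReal ε * (spectralDim B {t | a + ε < g t} : ℝ≥0∞) := by
        gcongr
        exact hdim _ (by linarith)
    _ ≤ _ := hB.le_traceOp_funCalc (.comp (continuous_slice _ _) (slice_zero ha hε.le) hg)
        (fun t => slice_nonneg hε.le _) hε.le fun t ht => by
          have : a + ε < g t := ht
          rw [slice, max_eq_left (by linarith), min_eq_right (by linarith)]

/-- Slices of thickness `ε` are stacked by induction on `m`. The lowest layer of `f`, of height `2 *
ε`, is discarded to pay for the shift between the slices of `f` and `g`. -/
theorem traceOp_truncation_le (hA : IsShiftedInverse A c T) (hB : IsShiftedInverse B c' T')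
    (hf : VanishesAtTop f) (hg : VanishesAtTop g) (hg0 : ∀ t, 0 ≤ g t)
    (hdim : ∀ θ > 0, spectralDim A {t | θ < f t} ≤ spectralDim B {t | θ < g t})
    {ε : ℝ} (hε : 0 < ε) (m : ℕ) :
    traceOp (funCalc A fun t => min (f t) ((m + 2) * ε) - min (f t) (2 * ε)) ≤
      traceOp (funCalc B fun t => min (g t) (m * ε)) := by
  induction m with
  | zero =>
    refine (le_of_eq ?_).trans zero_le
    have e : (fun t => min (f t) (((0 : ℕ) + 2) * ε) - min (f t) (2 * ε)) = fun t => 0 * f t := by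
      ext t
      simp
    rw [e, hA.traceOp_const_mul hf le_rfl, ENNReal.ofReal_zero, zero_mul]
  | succ m ih =>
    have eA : (fun t => min (f t) (((m + 1 : ℕ) + 2) * ε) - min (f t) (2 * ε)) = fun t =>
        (min (f t) ((m + 2) * ε) - min (f t) (2 * ε)) + slice (m * ε + 2 * ε) ε (f t) := by
      ext t
      have := min_add_slice (a := m * ε + 2 * ε) hε.le (f t)
      rw [show ((m + 1 : ℕ) + 2) * ε = m * ε + 2 * ε + ε by push_cast; ring, this]
      ring_nf
    have eB : (fun t => min (g t) ((m + 1 : ℕ) * ε)) = fun t =>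
        min (g t) (m * ε) + slice (m * ε) ε (g t) := by
      ext t
      rw [← min_add_slice hε.le]
      congr 1
      push_cast
      ring
    have hmε : 0 ≤ m * ε := by positivity
    rw [eA, eB, hA.traceOp_funCalc_add _ _ _ (fun t => slice_nonneg hε.le _),
      hB.traceOp_funCalc_add _ _ _ (fun t => slice_nonneg hε.le _)]
    · exact add_le_add ih (hA.traceOp_slice_le hB hf hg hdim hmε hε)
    · exact .comp (φ := fun y => min y (m * ε)) (by fun_prop) (by simp [hmε]) hg
    · exact .comp (continuous_slice _ _) (slice_zero hmε hε.le) hg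
    · exact fun t => le_min (hg0 t) hmε
    · exact .comp (φ := fun y => min y ((m + 2) * ε) - min y (2 * ε)) (by fun_prop)
        (by rw [min_eq_left (by positivity), min_eq_left (by positivity), sub_zero]) hf
    · exact .comp (continuous_slice _ _) (slice_zero (by positivity) hε.le) hf
    · refine fun t => sub_nonneg.2 (min_le_min le_rfl ?_)
      nlinarith

/-- A trace inequality from inequalities between the dimensions of spectral subspaces. -/
theorem traceOp_funCalc_le_of_spectralDim_le (hA : IsShiftedInverse A c T)
    (hB : IsShiftedInverse B c' T') (hf : VanishesAtTop f) (hg : VanishesAtTop g)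
    (hg0 : ∀ t, 0 ≤ g t) {M : ℝ} (hM : ∀ t, -c < t → f t ≤ M)
    (hdim : ∀ θ > 0, spectralDim A {t | θ < f t} ≤ spectralDim B {t | θ < g t}) :
    traceOp (funCalc A f) ≤ traceOp (funCalc B g) := by
  have key : ∀ ε > 0, traceOp (funCalc A fun t => f t - min (f t) (2 * ε)) ≤
      traceOp (funCalc B g) := by
    intro ε hε
    -- For such `m` the upper truncation at `(m + 2) * ε` does not change `f` at energies above
    -- `-c`, where `f ≤ M`.
    obtain ⟨m, hm⟩ := exists_nat_gt (M / ε)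
    rw [div_lt_iff₀ hε] at hm
    have hmε : 0 ≤ m * ε := by positivity
    have hv1 : VanishesAtTop fun t => f t - min (f t) (2 * ε) :=
      .comp (φ := fun y => y - min y (2 * ε)) (by fun_prop)
        (by rw [min_eq_left (by positivity), sub_zero]) hf
    have hv2 : VanishesAtTop fun t => min (f t) ((m + 2) * ε) - min (f t) (2 * ε) :=
      .comp (φ := fun y => min y ((m + 2) * ε) - min y (2 * ε)) (by fun_prop)
        (by rw [min_eq_left (by positivity), min_eq_left (by positivity), sub_zero]) hf
    rw [hA.funCalc_congr hv1 hv2 fun t ht => by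
      rw [min_eq_left (b := (m + 2) * ε)]
      linarith [hM t ht]]
    refine (hA.traceOp_truncation_le hB hf hg hg0 hdim hε m).trans (traceOp_mono ?_)
    exact hB.funCalc_mono (.comp (φ := fun y => min y (m * ε)) (by fun_prop) (by simp [hmε]) hg) hg
      fun t _ => min_le_left _ _
  -- The discarded layer may have infinite trace, but in a finite partial sum over `F` it costs at
  -- most `2 * ε` per basis vector. The choice of `ε` below keeps the total under `δ`.
  refine (ENNReal.tsum_eq_iSup_sum).trans_le (iSup_le fun F => ?_)
  refine ENNReal.le_of_forall_pos_le_add fun δ hδ _ => ?_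
  set ε : ℝ := δ / (2 * (F.card + 1)) with hεdef
  have hε : 0 < ε := by positivity
  have hv1 : VanishesAtTop fun t => f t - min (f t) (2 * ε) :=
    .comp (φ := fun y => y - min y (2 * ε)) (by fun_prop)
      (by rw [min_eq_left (by positivity), sub_zero]) hf
  have hv3 : VanishesAtTop fun t => min (f t) (2 * ε) :=
    .comp (φ := fun y => min y (2 * ε)) (by fun_prop)
      (by rw [min_eq_left (by positivity)]) hf
  set b := (exists_hilbertBasis ℂ 𝓗).choose_spec.choose with hb
  have hterm : ∀ i, ENNReal.ofReal (⟪b i, funCalc A f (b i)⟫_ℂ).re ≤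
      ENNReal.ofReal (⟪b i, funCalc A (fun t => f t - min (f t) (2 * ε)) (b i)⟫_ℂ).re +
        ENNReal.ofReal (2 * ε) := by
    intro i
    rw [← ENNReal.ofReal_add (hA.funCalc_nonneg hv1 (fun t _ => sub_nonneg.2 (min_le_left _ _)) _)
      (by positivity)]
    refine ENNReal.ofReal_le_ofReal ?_
    have h1 := hA.funCalc_le hv3 (r := 2 * ε) (by positivity) (fun t _ => min_le_right _ _) (b i)
    rw [b.orthonormal.1 i, one_pow, mul_one] at h1
    rw [hA.funCalc_sub_apply hf hv3, inner_sub_right, Complex.sub_re]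
    linarith
  calc _ ≤ ∑ i ∈ F, (ENNReal.ofReal
          (⟪b i, funCalc A (fun t => f t - min (f t) (2 * ε)) (b i)⟫_ℂ).re +
        ENNReal.ofReal (2 * ε)) := Finset.sum_le_sum fun i _ => hterm i
    _ = ∑ i ∈ F, ENNReal.ofReal
          (⟪b i, funCalc A (fun t => f t - min (f t) (2 * ε)) (b i)⟫_ℂ).re +
        F.card * ENNReal.ofReal (2 * ε) := by
          rw [Finset.sum_add_distrib, Finset.sum_const, nsmul_eq_mul]
    _ ≤ traceOp (funCalc B g) + δ := by
          refine add_le_add ((ENNReal.sum_le_tsum F).trans (key ε hε)) ?_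
          rw [← ENNReal.ofReal_natCast, ← ENNReal.ofReal_mul (by positivity),
            ← ENNReal.ofReal_coe_nnreal]
          refine ENNReal.ofReal_le_ofReal ?_
          have : (F.card : ℝ) * (2 * ε) = δ * (F.card / (F.card + 1)) := by
            rw [hεdef]
            field_simp
          rw [this]
          refine mul_le_of_le_one_right δ.2 ((div_le_one (by positivity)).2 (by linarith))

section FormComparison

variable {K₁ K₂ : Type*} [NormedAddCommGroup K₁] [InnerProductSpace ℂ K₁]
    [CompleteSpace K₁] [NormedAddCommGroup K₂] [InnerProductSpace ℂ K₂] [CompleteSpace K₂]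
    {c₁ c₂ κ : ℝ} {j₁ : K₁ →L[ℂ] 𝓗} {j₂ : K₂ →L[ℂ] 𝓗}

theorem numNegative_le
    (hA : IsShiftedInverse A c₁ (j₁ ∘L ContinuousLinearMap.adjoint j₁))
    (hB : IsShiftedInverse B c₂ (j₂ ∘L ContinuousLinearMap.adjoint j₂)) (hκ : 0 < κ)
    (hcmp : ∀ k₁, ∃ k₂, j₂ k₂ = j₁ k₁ ∧
      κ * (‖k₂‖ ^ 2 - c₂ * ‖j₁ k₁‖ ^ 2) ≤ ‖k₁‖ ^ 2 - c₁ * ‖j₁ k₁‖ ^ 2) :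
    numNegative A ≤ numNegative B := by
  have := rank_spectralSubspace_le hA hB hκ hcmp 0
  rwa [mul_zero] at this

/-- For `θ > 0` the superlevel sets of `max (-t) 0 ^ p` and of `κ ^ p * max (-t) 0 ^ p` are the
half-lines below `-θ^(1/p)` and `-θ^(1/p) / κ`. These endpoints differ by the factor `κ`, exactly as
in `rank_spectralSubspace_le`. The function is bounded on energies above `-c₁`, as the trace
comparison requires. -/
theorem liebThirring_le
    (hA : IsShiftedInverse A c₁ (j₁ ∘L ContinuousLinearMap.adjoint j₁))
    (hB : IsShiftedInverse B c₂ (j₂ ∘L ContinuousLinearMap.adjoint j₂)) (hκ : 0 < κ)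
    (hcmp : ∀ k₁, ∃ k₂, j₂ k₂ = j₁ k₁ ∧
      κ * (‖k₂‖ ^ 2 - c₂ * ‖j₁ k₁‖ ^ 2) ≤ ‖k₁‖ ^ 2 - c₁ * ‖j₁ k₁‖ ^ 2) {p : ℝ} (hp : 0 < p) :
    liebThirring p A ≤ ENNReal.ofReal (κ ^ p) * liebThirring p B := by
  have hv : VanishesAtTop fun t => max (-t) 0 ^ p := by
    refine ⟨Continuous.rpow_const (by fun_prop) fun _ => Or.inr hp.le, ?_⟩
    filter_upwards [eventually_ge_atTop 0] with t ht
    rw [max_eq_right (by linarith), Real.zero_rpow hp.ne']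
  have hset : ∀ r : ℝ, 0 < r → ∀ θ > 0,
      {t : ℝ | θ < r ^ p * max (-t) 0 ^ p} = Set.Iio (-(θ ^ p⁻¹ / r)) := by
    intro r hr θ hθ
    ext t
    rw [Set.mem_ofPred_eq, Set.mem_Iio, ← Real.mul_rpow hr.le (le_max_right _ _),
      ← Real.rpow_inv_lt_iff_of_pos hθ.le (by positivity) hp, ← div_lt_iff₀' hr, lt_max_iff,
      or_iff_left (not_lt_of_ge (by positivity)), lt_neg]
  have h := hA.traceOp_funCalc_le_of_spectralDim_le hB hv
    (hv.mul_left (continuous_const (y := κ ^ p)))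
    (fun t => by positivity) (M := max c₁ 0 ^ p) (fun t ht => by
      refine Real.rpow_le_rpow (le_max_right _ _) (max_le_max (by linarith) le_rfl) hp.le)
    fun θ hθ => by
      have h1 := hset 1 one_pos θ hθ
      simp only [Real.one_rpow, one_mul, div_one] at h1
      rw [hset κ hκ θ hθ, h1]
      have := rank_spectralSubspace_le hA hB hκ hcmp (-(θ ^ p⁻¹ / κ))
      rwa [mul_neg, mul_div_cancel₀ _ hκ.ne'] at this
  rwa [hB.traceOp_const_mul hv (by positivity)] at h

end FormComparison

end IsShiftedInverse

end Abstract

/-! ### Closed semibounded forms as Hilbert spaces. -/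

section FormSpace

universe w

variable {D : Type w} {𝓗 ι : Type*} [AddCommGroup D] [Module ℂ D] [NormedAddCommGroup 𝓗]
  [InnerProductSpace ℂ 𝓗] [Fintype ι]

/-- The sesquilinear form `∑ ⟨Gᵢ v, Gᵢ u⟩ - ⟨N v, N u⟩ + c ⟨J v, J u⟩`. -/
def shiftedForm (J N : D →ₗ[ℂ] 𝓗) (G : ι → D →ₗ[ℂ] 𝓗) (c : ℝ) (v u : D) : ℂ :=
  ∑ i, ⟪G i v, G i u⟫_ℂ - ⟪N v, N u⟫_ℂ + c * ⟪J v, J u⟫_ℂ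

theorem re_shiftedForm_self (J N : D →ₗ[ℂ] 𝓗) (G : ι → D →ₗ[ℂ] 𝓗) (c : ℝ) (u : D) :
    (shiftedForm J N G c u u).re = ∑ i, ‖G i u‖ ^ 2 - ‖N u‖ ^ 2 + c * ‖J u‖ ^ 2 := by
  have h : ∀ x : 𝓗, (⟪x, x⟫_ℂ).re = ‖x‖ ^ 2 := fun x => (norm_sq_eq_re_inner (𝕜 := ℂ) x).symm
  simp only [shiftedForm, Complex.add_re, Complex.sub_re, Complex.re_sum, Complex.re_ofReal_mul, h]

/-- In the shift `|b| + 1`, the `|b|` absorbs the lower-order term of the form bound, and the `1`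
leaves a full `‖J u‖²`, which makes the form definite and the inclusion a contraction. -/
theorem re_shiftedForm_self_ge {J N : D →ₗ[ℂ] 𝓗} {G : ι → D →ₗ[ℂ] 𝓗} {a b : ℝ}
    (hN : ∀ u, ‖N u‖ ^ 2 ≤ a * ∑ i, ‖G i u‖ ^ 2 + b * ‖J u‖ ^ 2) (u : D) :
    (1 - a) * ∑ i, ‖G i u‖ ^ 2 + ‖J u‖ ^ 2 ≤ (shiftedForm J N G (|b| + 1) u u).re := by
  rw [re_shiftedForm_self]
  nlinarith [hN u, mul_le_mul_of_nonneg_right (le_abs_self b) (sq_nonneg ‖J u‖)]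

/-- The inner product of the form norm of a form that is bounded below. -/
@[reducible]
def formCore {J N : D →ₗ[ℂ] 𝓗} {G : ι → D →ₗ[ℂ] 𝓗} {a b : ℝ} (ha : a < 1)
    (hJ : Function.Injective J)
    (hN : ∀ u, ‖N u‖ ^ 2 ≤ a * ∑ i, ‖G i u‖ ^ 2 + b * ‖J u‖ ^ 2) : InnerProductSpace.Core ℂ D where
  inner v u := shiftedForm J N G (|b| + 1) v u
  conj_inner_symm v u := by
    simp only [shiftedForm, map_add, map_sub, map_sum, map_mul, inner_conj_symm, Complex.conj_ofReal]
  re_inner_nonneg u := by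
    refine le_trans ?_ (re_shiftedForm_self_ge hN u)
    have := sub_pos.2 ha
    positivity
  add_left v w u := by
    simp only [shiftedForm, map_add, inner_add_left, Finset.sum_add_distrib]
    ring
  smul_left v u r := by
    simp only [shiftedForm, map_smul, inner_smul_left, ← Finset.mul_sum]
    ring
  definite u hu := by
    have h1 := re_shiftedForm_self_ge hN u
    have h2 : (shiftedForm J N G (|b| + 1) u u).re = 0 := by
      rw [show shiftedForm J N G (|b| + 1) u u = 0 from hu, Complex.zero_re]
    have h3 : 0 ≤ (1 - a) * ∑ i, ‖G i u‖ ^ 2 := by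
      have := sub_pos.2 ha
      positivity
    have h4 : ‖J u‖ ^ 2 = 0 := le_antisymm (by linarith) (sq_nonneg _)
    have h5 : J u = 0 := by simpa using h4
    exact hJ (h5.trans (map_zero J).symm)

/-- A closed form that is bounded below makes its domain a Hilbert space. -/
theorem exists_formSpace [CompleteSpace 𝓗] {J N : D →ₗ[ℂ] 𝓗} {G : ι → D →ₗ[ℂ] 𝓗} {a b : ℝ}
    (ha : a < 1) (hJ : Function.Injective J)
    (hN : ∀ u, ‖N u‖ ^ 2 ≤ a * ∑ i, ‖G i u‖ ^ 2 + b * ‖J u‖ ^ 2)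
    (hclosed : ∀ (u : ℕ → D) (x z : 𝓗) (y : ι → 𝓗), Tendsto (fun n => J (u n)) atTop (𝓝 x) →
      Tendsto (fun n => N (u n)) atTop (𝓝 z) →
      (∀ i, Tendsto (fun n => G i (u n)) atTop (𝓝 (y i))) → ∃ w, J w = x ∧ ∀ i, G i w = y i) :
    ∃ (K : Type w) (_ : NormedAddCommGroup K) (_ : InnerProductSpace ℂ K) (_ : CompleteSpace K)
      (j : K →L[ℂ] 𝓗) (e : K → D), Function.Surjective e ∧ (∀ k, j k = J (e k)) ∧
        ∀ k l : K, ⟪k, l⟫_ℂ = shiftedForm J N G (|b| + 1) (e k) (e l) := by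
  let core := formCore ha hJ hN
  let _ : NormedAddCommGroup D := core.toNormedAddCommGroup
  let _ : InnerProductSpace ℂ D := InnerProductSpace.ofCore core.toCore
  have hinner : ∀ v u : D, ⟪v, u⟫_ℂ = shiftedForm J N G (|b| + 1) v u := fun _ _ => rfl
  have hnorm : ∀ u : D, ‖u‖ ^ 2 = ∑ i, ‖G i u‖ ^ 2 - ‖N u‖ ^ 2 + (|b| + 1) * ‖J u‖ ^ 2 := fun u => by
    rw [← re_shiftedForm_self, ← hinner]
    exact norm_sq_eq_re_inner (𝕜 := ℂ) u
  have hlow : ∀ u : D, (1 - a) * ∑ i, ‖G i u‖ ^ 2 + ‖J u‖ ^ 2 ≤ ‖u‖ ^ 2 := fun u => by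
    rw [hnorm, ← re_shiftedForm_self]
    exact re_shiftedForm_self_ge hN u
  have ha' : 0 < 1 - a := sub_pos.2 ha
  have hJb : ∀ u : D, ‖J u‖ ≤ 1 * ‖u‖ := fun u => by
    rw [one_mul]
    refine le_of_sq_le_sq ?_ (norm_nonneg _)
    have : 0 ≤ (1 - a) * ∑ i, ‖G i u‖ ^ 2 := by positivity
    linarith [hlow u]
  have hGb : ∀ i, ∀ u : D, ‖G i u‖ ≤ √((1 - a)⁻¹) * ‖u‖ := fun i u => by
    refine le_of_sq_le_sq ?_ (by positivity)
    rw [mul_pow, Real.sq_sqrt (by positivity), inv_mul_eq_div, le_div_iff₀ ha', mul_comm]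
    have h1 : ‖G i u‖ ^ 2 ≤ ∑ i, ‖G i u‖ ^ 2 :=
      Finset.single_le_sum (f := fun i => ‖G i u‖ ^ 2) (fun _ _ => by positivity)
        (Finset.mem_univ i)
    have h2 := mul_le_mul_of_nonneg_left h1 ha'.le
    linarith [hlow u, sq_nonneg ‖J u‖]
  have hNb : ∀ u : D, ‖N u‖ ≤ √((1 - a)⁻¹ + |b|) * ‖u‖ := fun u => by
    refine le_of_sq_le_sq ?_ (by positivity)
    rw [mul_pow, Real.sq_sqrt (by positivity), add_mul]
    have h0 : 0 ≤ ∑ i, ‖G i u‖ ^ 2 := by positivity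
    have h1 : ∑ i, ‖G i u‖ ^ 2 ≤ (1 - a)⁻¹ * ‖u‖ ^ 2 := by
      rw [inv_mul_eq_div, le_div_iff₀ ha', mul_comm]
      linarith [hlow u, sq_nonneg ‖J u‖]
    have h2 : ‖J u‖ ^ 2 ≤ ‖u‖ ^ 2 := by
      have := mul_nonneg ha'.le h0
      linarith [hlow u]
    nlinarith [hN u, mul_le_mul_of_nonneg_left h2 (abs_nonneg b),
      mul_le_mul_of_nonneg_right (le_abs_self b) (sq_nonneg ‖J u‖)]
  let j : D →L[ℂ] 𝓗 := J.mkContinuous 1 hJb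
  let g : ι → D →L[ℂ] 𝓗 := fun i => (G i).mkContinuous _ (hGb i)
  let l : D →L[ℂ] 𝓗 := N.mkContinuous _ hNb
  have hcomplete : CompleteSpace D := by
    -- The components `J`, `N` and `G i` are bounded in the form norm, so a Cauchy sequence
    -- converges in each of them, and closedness supplies the limit `w`. Convergence in form norm
    -- then needs only `J` and `G`, since `N` enters the norm with a negative sign.
    refine Metric.complete_of_cauchySeq_tendsto fun u hu => ?_
    obtain ⟨x, hx⟩ := cauchySeq_tendsto_of_complete (j.uniformContinuous.comp_cauchySeq hu)
    obtain ⟨z, hz⟩ := cauchySeq_tendsto_of_complete (l.uniformContinuous.comp_cauchySeq hu)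
    choose y hy using fun i => cauchySeq_tendsto_of_complete ((g i).uniformContinuous.comp_cauchySeq hu)
    obtain ⟨w, hw, hwy⟩ := hclosed u x z y hx hz hy
    refine ⟨w, tendsto_iff_norm_sub_tendsto_zero.2 ?_⟩
    have hlim : Tendsto (fun n => √(∑ i, ‖G i (u n) - y i‖ ^ 2 + (|b| + 1) * ‖J (u n) - x‖ ^ 2))
        atTop (𝓝 0) := by
      have h1 : Tendsto (fun n => ‖J (u n) - x‖) atTop (𝓝 0) :=
        tendsto_iff_norm_sub_tendsto_zero.1 hx
      have h2 : ∀ i, Tendsto (fun n => ‖G i (u n) - y i‖) atTop (𝓝 0) := fun i =>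
        tendsto_iff_norm_sub_tendsto_zero.1 (hy i)
      have h3 := ((tendsto_finsetSum Finset.univ fun i _ => (h2 i).pow 2).add
        ((h1.pow 2).const_mul (|b| + 1))).sqrt
      simpa using h3
    refine squeeze_zero (fun _ => norm_nonneg _) (fun n => ?_) hlim
    refine Real.le_sqrt_of_sq_le ?_
    rw [hnorm]
    simp only [map_sub, hw, hwy]
    linarith [sq_nonneg ‖N (u n) - N w‖]
  exact ⟨D, inferInstance, inferInstance, hcomplete, j, id, Function.surjective_id, fun _ => rfl,
    hinner⟩

end FormSpace

/-! ### Test functions, multiplication operators and weak derivatives in `L²`. -/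

section Tools

variable {ν : ℕ}

/-- The pairing with a continuous function of compact support, as an inner product. -/
theorem exists_inner_eq_integral_smul {ψ : EuclideanSpace ℝ (Fin ν) → ℝ} (hψ : Continuous ψ)
    (hc : HasCompactSupport ψ) : ∃ Ψ : L2 ν, (Ψ =ᵐ[volume] fun x => (ψ x : ℂ)) ∧
      ∀ u : L2 ν, ∫ x, ψ x • u x = ⟪Ψ, u⟫_ℂ := by
  have hm : MemLp (fun x => (ψ x : ℂ)) 2 volume :=
    (Complex.continuous_ofReal.comp hψ).memLp_of_hasCompactSupport (hc.comp_left (by simp))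
  refine ⟨hm.toLp, hm.coeFn_toLp, fun u => ?_⟩
  rw [L2.inner_def]
  refine integral_congr_ae ?_
  filter_upwards [hm.coeFn_toLp] with x hx
  rw [hx, RCLike.inner_apply, Complex.conj_ofReal, Complex.real_smul, mul_comm]

theorem HasWeakPartial.of_tendsto {i : Fin ν} {u g : ℕ → L2 ν} {u₀ g₀ : L2 ν}
    (h : ∀ n, HasWeakPartial i (u n) (g n)) (hu : Tendsto u atTop (𝓝 u₀))
    (hg : Tendsto g atTop (𝓝 g₀)) : HasWeakPartial i u₀ g₀ := by
  intro φ hφ hc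
  obtain ⟨Ψ, -, hΨ⟩ := exists_inner_eq_integral_smul hφ.continuous hc
  obtain ⟨Ψ', -, hΨ'⟩ := exists_inner_eq_integral_smul
    (ψ := fun x => fderiv ℝ φ x (EuclideanSpace.single i 1))
    ((hφ.continuous_fderiv (by simp)).clm_apply continuous_const) (hc.fderiv_apply (𝕜 := ℝ) _)
  rw [hΨ, hΨ']
  have h1 : Tendsto (fun n => ⟪Ψ', u n⟫_ℂ) atTop (𝓝 ⟪Ψ', u₀⟫_ℂ) := tendsto_const_nhds.inner hu
  have h2 : Tendsto (fun n => -⟪Ψ, g n⟫_ℂ) atTop (𝓝 (-⟪Ψ, g₀⟫_ℂ)) :=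
    (tendsto_const_nhds.inner hg).neg
  refine tendsto_nhds_unique h1 (h2.congr fun n => ?_)
  rw [← hΨ, ← hΨ', h n φ hφ hc]

/-- Multiplication by a function is a closed operator. -/
theorem smul_ae_eq_of_tendsto {ρ : EuclideanSpace ℝ (Fin ν) → ℝ} {u w : ℕ → L2 ν} {u₀ w₀ : L2 ν}
    (h : ∀ n, w n =ᵐ[volume] fun x => ρ x • u n x) (hu : Tendsto u atTop (𝓝 u₀))
    (hw : Tendsto w atTop (𝓝 w₀)) : w₀ =ᵐ[volume] fun x => ρ x • u₀ x := by
  -- The second subsequence is extracted from the first, so that both `u` and `w` converge almost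
  -- everywhere along it.
  obtain ⟨ns, hns, h1⟩ := (tendstoInMeasure_of_tendsto_Lp hu).exists_seq_tendsto_ae
  obtain ⟨ms, hms, h2⟩ := (tendstoInMeasure_of_tendsto_Lp
    (hw.comp hns.tendsto_atTop)).exists_seq_tendsto_ae
  filter_upwards [h1, h2, ae_all_iff.2 h] with x hx1 hx2 hx
  have h3 : Tendsto (fun n => ρ x • u (ns (ms n)) x) atTop (𝓝 (ρ x • u₀ x)) :=
    (hx1.comp hms.tendsto_atTop).const_smul _
  refine tendsto_nhds_unique hx2 (h3.congr fun n => ?_)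
  rw [← hx]
  rfl

/-- Multiplication by `ρ` as a linear map into `L²`, on a space of functions `u` with
`ρ u ∈ L²`. -/
def mulMap (ρ : EuclideanSpace ℝ (Fin ν) → ℝ) (D : Submodule ℂ (L2 ν))
    (h : ∀ u ∈ D, MemLp (fun x => ρ x • u x) 2 volume) : D →ₗ[ℂ] L2 ν where
  toFun u := (h u u.2).toLp
  map_add' u v := by
    refine Lp.ext ?_
    filter_upwards [(h _ (u + v).2).coeFn_toLp, (h u u.2).coeFn_toLp, (h v v.2).coeFn_toLp,
      Lp.coeFn_add (h u u.2).toLp (h v v.2).toLp, Lp.coeFn_add (u : L2 ν) v] with x h1 h2 h3 h4 h5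
    rw [h1, h4, Pi.add_apply, h2, h3, Submodule.coe_add, h5, Pi.add_apply, smul_add]
  map_smul' r u := by
    refine Lp.ext ?_
    filter_upwards [(h _ (r • u).2).coeFn_toLp, (h u u.2).coeFn_toLp,
      Lp.coeFn_smul r (h u u.2).toLp, Lp.coeFn_smul r (u : L2 ν)] with x h1 h2 h3 h4
    rw [h1, RingHom.id_apply, h3, Pi.smul_apply, h2, Submodule.coe_smul, h4, Pi.smul_apply,
      smul_comm]

theorem coeFn_mulMap {ρ : EuclideanSpace ℝ (Fin ν) → ℝ} {D : Submodule ℂ (L2 ν)}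
    (h : ∀ u ∈ D, MemLp (fun x => ρ x • u x) 2 volume) (u : D) :
    mulMap ρ D h u =ᵐ[volume] fun x => ρ x • (u : L2 ν) x :=
  (h u u.2).coeFn_toLp

/-- The weak partial derivative as a linear map on a space of functions in `H¹`. -/
def partialMap (i : Fin ν) (D : Submodule ℂ (L2 ν)) (h : D ≤ sobolevH1 ν) : D →ₗ[ℂ] L2 ν where
  toFun u := weakPartial i u
  map_add' u v := ((hasWeakPartial_weakPartial (h u.2) i).add
    (hasWeakPartial_weakPartial (h v.2) i)).weakPartial_eq
  map_smul' r u := ((hasWeakPartial_weakPartial (h u.2) i).smul r).weakPartial_eq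

/-- Test functions belong to the Sobolev space. -/
theorem hasWeakPartial_test (i : Fin ν) {ψ : EuclideanSpace ℝ (Fin ν) → ℝ} (hψ : ContDiff ℝ ∞ ψ)
    (hc : HasCompactSupport ψ) {Ψ Ψ' : L2 ν} (h : Ψ =ᵐ[volume] fun x => (ψ x : ℂ))
    (h' : Ψ' =ᵐ[volume] fun x => (fderiv ℝ ψ x (EuclideanSpace.single i 1) : ℂ)) :
    HasWeakPartial i Ψ Ψ' := by
  intro φ hφ hφc
  have e1 : ∫ x, fderiv ℝ φ x (EuclideanSpace.single i 1) • Ψ x =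
      ((∫ x, fderiv ℝ φ x (EuclideanSpace.single i 1) * ψ x : ℝ) : ℂ) := by
    rw [← integral_complex_ofReal]
    refine integral_congr_ae ?_
    filter_upwards [h] with x hx
    rw [hx, Complex.real_smul]
    push_cast
    rfl
  have e2 : ∫ x, φ x • Ψ' x =
      ((∫ x, φ x * fderiv ℝ ψ x (EuclideanSpace.single i 1) : ℝ) : ℂ) := by
    rw [← integral_complex_ofReal]
    refine integral_congr_ae ?_
    filter_upwards [h'] with x hx
    rw [hx, Complex.real_smul]
    push_cast
    rfl
  have hdφ : Continuous fun x => fderiv ℝ φ x (EuclideanSpace.single i 1) :=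
    (hφ.continuous_fderiv (by simp)).clm_apply continuous_const
  have hdψ : Continuous fun x => fderiv ℝ ψ x (EuclideanSpace.single i 1) :=
    (hψ.continuous_fderiv (by simp)).clm_apply continuous_const
  rw [e1, e2, integral_mul_fderiv_eq_neg_fderiv_mul_of_integrable]
  · push_cast
    rw [neg_neg]
  · exact (hdφ.mul hψ.continuous).integrable_of_hasCompactSupport hc.mul_left
  · exact (hφ.continuous.mul hdψ).integrable_of_hasCompactSupport hφc.mul_right
  · exact (hφ.continuous.mul hψ.continuous).integrable_of_hasCompactSupport hφc.mul_right
  · exact fun x _ => hφ.differentiable (by simp) x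
  · exact fun x _ => hψ.differentiable (by simp) x

/-- The form domain of a locally integrable potential is dense. -/
theorem eq_zero_of_orthogonal_formDomain {V : EuclideanSpace ℝ (Fin ν) → ℝ}
    (hV : LocallyIntegrable V) {u : L2 ν} (hu : ∀ v ∈ formDomain V, ⟪v, u⟫_ℂ = 0) : u = 0 := by
  refine Lp.ext ?_
  have h0 : ∀ᵐ x ∂volume, u x = 0 := ae_eq_zero_of_integral_contDiff_smul_eq_zero
      ((Lp.memLp u).locallyIntegrable (by norm_num)) ?_
  · filter_upwards [h0, Lp.coeFn_zero ℂ 2 (volume : Measure (EuclideanSpace ℝ (Fin ν)))] with x h1 h2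
    rw [h1, h2, Pi.zero_apply]
  intro φ hφ hc
  obtain ⟨Ψ, hΨ, hΨu⟩ := exists_inner_eq_integral_smul hφ.continuous hc
  rw [hΨu]
  refine hu _ ⟨fun i => ?_, ?_⟩
  · obtain ⟨Ψ', hΨ', -⟩ := exists_inner_eq_integral_smul
      (ψ := fun x => fderiv ℝ φ x (EuclideanSpace.single i 1))
      ((hφ.continuous_fderiv (by simp)).clm_apply continuous_const) (hc.fderiv_apply (𝕜 := ℝ) _)
    exact ⟨Ψ', hasWeakPartial_test i hφ hc hΨ hΨ'⟩
  · have hmeas : AEStronglyMeasurable (fun x => √|V x| • Ψ x) volume :=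
      (hV.aestronglyMeasurable.aemeasurable.abs.sqrt.aestronglyMeasurable).smul
        (Lp.aestronglyMeasurable Ψ)
    rw [memLp_two_iff_integrable_sq_norm hmeas]
    -- Local integrability of `V` is what puts test functions in the form domain: `|V| φ²` is
    -- integrable.
    have hi : Integrable fun x => (φ x ^ 2) • V x :=
      hV.integrable_smul_left_of_hasCompactSupport (hφ.continuous.pow 2)
        (hc.comp_left (g := fun y : ℝ => y ^ 2) (zero_pow two_ne_zero))
    refine hi.norm.congr ?_
    filter_upwards [hΨ] with x hx
    rw [hx, norm_smul, norm_smul, mul_pow, Real.norm_of_nonneg (Real.sqrt_nonneg _),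
      Real.sq_sqrt (abs_nonneg _), Complex.norm_real, norm_pow, Real.norm_eq_abs (V x), mul_comm]

end Tools

/-! ### The operator `-Δ + V` and its shifted inverse. -/

section Hamiltonian

variable {ν : ℕ} {V : EuclideanSpace ℝ (Fin ν) → ℝ}

theorem sqrt_abs_eq (y : ℝ) : √|y| = √y + √(-y) := by
  rcases le_total 0 y with h | h
  · rw [abs_of_nonneg h, Real.sqrt_eq_zero_of_nonpos (neg_nonpos.2 h), add_zero]
  · rw [abs_of_nonpos h, Real.sqrt_eq_zero_of_nonpos h, zero_add]

theorem eq_sqrt_sq_sub_sqrt_neg_sq (y : ℝ) : y = √y ^ 2 - √(-y) ^ 2 := by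
  rcases le_total 0 y with h | h
  · rw [Real.sqrt_eq_zero_of_nonpos (neg_nonpos.2 h), Real.sq_sqrt h]
    ring
  · rw [Real.sqrt_eq_zero_of_nonpos h, Real.sq_sqrt (neg_nonneg.2 h)]
    ring

theorem memLp_sqrt_smul (hV : AEStronglyMeasurable V volume) {u : L2 ν} (hu : u ∈ formDomain V) :
    MemLp (fun x => √(V x) • u x) 2 volume := by
  refine hu.2.of_le (hV.aemeasurable.sqrt.aestronglyMeasurable.smul (Lp.aestronglyMeasurable u))
    (.of_forall fun x => ?_)
  rw [norm_smul, norm_smul, Real.norm_of_nonneg (Real.sqrt_nonneg _),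
    Real.norm_of_nonneg (Real.sqrt_nonneg _)]
  gcongr
  exact le_abs_self _

theorem memLp_sqrt_neg_smul (hV : AEStronglyMeasurable V volume) {u : L2 ν}
    (hu : u ∈ formDomain V) : MemLp (fun x => √(-V x) • u x) 2 volume := by
  refine hu.2.of_le (hV.aemeasurable.neg.sqrt.aestronglyMeasurable.smul
    (Lp.aestronglyMeasurable u)) (.of_forall fun x => ?_)
  rw [norm_smul, norm_smul, Real.norm_of_nonneg (Real.sqrt_nonneg _),
    Real.norm_of_nonneg (Real.sqrt_nonneg _)]
  gcongr
  exact neg_le_abs _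

/-- Multiplication by the square root of the positive part of the potential. -/
def sqrtPos (hV : AEStronglyMeasurable V volume) : formDomain V →ₗ[ℂ] L2 ν :=
  mulMap (fun x => √(V x)) (formDomain V) fun _ hu => memLp_sqrt_smul hV hu

/-- Multiplication by the square root of the negative part of the potential. -/
def sqrtNeg (hV : AEStronglyMeasurable V volume) : formDomain V →ₗ[ℂ] L2 ν :=
  mulMap (fun x => √(-V x)) (formDomain V) fun _ hu => memLp_sqrt_neg_smul hV hu

/-- The weak partial derivatives and the square root of the positive part of the potential. -/
def posPart (hV : AEStronglyMeasurable V volume) : Option (Fin ν) → formDomain V →ₗ[ℂ] L2 ν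
  | none => sqrtPos hV
  | some i => partialMap i (formDomain V) fun _ hu => hu.1

theorem coeFn_sqrtPos (hV : AEStronglyMeasurable V volume) (u : formDomain V) :
    sqrtPos hV u =ᵐ[volume] fun x => √(V x) • (u : L2 ν) x := coeFn_mulMap _ u

theorem coeFn_sqrtNeg (hV : AEStronglyMeasurable V volume) (u : formDomain V) :
    sqrtNeg hV u =ᵐ[volume] fun x => √(-V x) • (u : L2 ν) x := coeFn_mulMap _ u

theorem conj_mul_potential_ae_eq (hV : AEStronglyMeasurable V volume) (v u : formDomain V) :
    (fun x => conj ((v : L2 ν) x) * ((V x : ℂ) * (u : L2 ν) x)) =ᵐ[volume]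
      fun x => ⟪sqrtPos hV v x, sqrtPos hV u x⟫_ℂ - ⟪sqrtNeg hV v x, sqrtNeg hV u x⟫_ℂ := by
  filter_upwards [coeFn_sqrtPos hV v, coeFn_sqrtPos hV u, coeFn_sqrtNeg hV v,
    coeFn_sqrtNeg hV u] with x h1 h2 h3 h4
  rw [h1, h2, h3, h4]
  simp only [RCLike.inner_apply, Complex.real_smul, map_mul, Complex.conj_ofReal]
  have : (V x : ℂ) = (√(V x) : ℂ) ^ 2 - (√(-V x) : ℂ) ^ 2 := by
    exact_mod_cast congrArg (Complex.ofReal) (eq_sqrt_sq_sub_sqrt_neg_sq (V x))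
  rw [this]
  ring

theorem integrable_conj_mul_potential (hV : AEStronglyMeasurable V volume) (v u : formDomain V) :
    Integrable fun x => conj ((v : L2 ν) x) * ((V x : ℂ) * (u : L2 ν) x) :=
  (integrable_congr (conj_mul_potential_ae_eq hV v u)).2
    ((L2.integrable_inner _ _).sub (L2.integrable_inner _ _))

theorem integrable_potential_mul_norm_sq (hV : AEStronglyMeasurable V volume) {u : L2 ν}
    (hu : u ∈ formDomain V) : Integrable fun x => V x * ‖u x‖ ^ 2 := by
  refine (integrable_conj_mul_potential hV ⟨u, hu⟩ ⟨u, hu⟩).re.congr (.of_forall fun x => ?_)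
  have : conj (u x) * ((V x : ℂ) * u x) = ((V x * ‖u x‖ ^ 2 : ℝ) : ℂ) := by
    rw [mul_left_comm, Complex.conj_mul']
    push_cast
    rfl
  simp only [this, RCLike.re_to_complex, Complex.ofReal_re]

theorem form_eq (hV : AEStronglyMeasurable V volume) (v u : formDomain V) (c : ℝ) :
    form V v u + c * ⟪(v : L2 ν), u⟫_ℂ =
      shiftedForm (formDomain V).subtype (sqrtNeg hV) (posPart hV) c v u := by
  rw [form, integral_congr_ae (conj_mul_potential_ae_eq hV v u),
    integral_sub (L2.integrable_inner _ _) (L2.integrable_inner _ _), ← L2.inner_def,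
    ← L2.inner_def, shiftedForm, Fintype.sum_option]
  simp only [posPart, partialMap, LinearMap.coe_mk, AddHom.coe_mk, Submodule.subtype_apply]
  ring

theorem re_form_self (V : EuclideanSpace ℝ (Fin ν) → ℝ) (u : L2 ν) :
    (form V u u).re = energy V u := by
  have h : (fun x => conj (u x) * ((V x : ℂ) * u x)) = fun x => ((V x * ‖u x‖ ^ 2 : ℝ) : ℂ) := by
    ext x
    rw [mul_left_comm, Complex.conj_mul']
    push_cast
    rfl
  rw [form, h, integral_complex_ofReal, energy, kinetic, Complex.add_re, Complex.ofReal_re,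
    Complex.re_sum]
  congr 1
  exact Finset.sum_congr rfl fun i _ => (norm_sq_eq_re_inner (𝕜 := ℂ) _).symm

/-- Replacing `b` by `|b|` makes the right side nonnegative, so the bound between truncated values
`ENNReal.ofReal` becomes a bound between reals. The positive part of `V` is added to the kinetic
energy at no cost. -/
theorem norm_sqrtNeg_sq_le (hV : AEStronglyMeasurable V volume) {a b : ℝ} (ha : 0 ≤ a)
    (h : ∀ u ∈ sobolevH1 ν, ∫⁻ x, ENNReal.ofReal (max (-V x) 0 * ‖u x‖ ^ 2) ≤
      ENNReal.ofReal (a * kinetic u + b * ‖u‖ ^ 2)) (u : formDomain V) :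
    ‖sqrtNeg hV u‖ ^ 2 ≤
      a * ∑ i, ‖posPart hV i u‖ ^ 2 + |b| * ‖(formDomain V).subtype u‖ ^ 2 := by
  have h1 : ENNReal.ofReal (‖sqrtNeg hV u‖ ^ 2) =
      ∫⁻ x, ENNReal.ofReal (max (-V x) 0 * ‖(u : L2 ν) x‖ ^ 2) := by
    have e : ‖sqrtNeg hV u‖ ^ 2 = ∫ x, ‖sqrtNeg hV u x‖ ^ 2 := by
      rw [norm_sq_eq_re_inner (𝕜 := ℂ), L2.inner_def, ← integral_re (L2.integrable_inner _ _)]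
      refine integral_congr_ae (.of_forall fun x => ?_)
      exact (norm_sq_eq_re_inner (𝕜 := ℂ) _).symm
    rw [e, ofReal_integral_eq_lintegral_ofReal
      ((memLp_two_iff_integrable_sq_norm (Lp.aestronglyMeasurable _)).1 (Lp.memLp _))
      (.of_forall fun x => by positivity)]
    refine lintegral_congr_ae ?_
    filter_upwards [coeFn_sqrtNeg hV u] with x hx
    rw [hx, norm_smul, mul_pow, Real.norm_of_nonneg (Real.sqrt_nonneg _)]
    congr 2
    rcases le_total 0 (-V x) with h0 | h0
    · rw [Real.sq_sqrt h0, max_eq_left h0]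
    · rw [Real.sqrt_eq_zero_of_nonpos h0, max_eq_right h0, zero_pow two_ne_zero]
  have h2 := h u u.2.1
  rw [← h1] at h2
  have hk : 0 ≤ kinetic (u : L2 ν) := Finset.sum_nonneg fun i _ => by positivity
  have h3 : a * kinetic (u : L2 ν) + b * ‖(u : L2 ν)‖ ^ 2 ≤
      a * kinetic (u : L2 ν) + |b| * ‖(u : L2 ν)‖ ^ 2 := by
    gcongr
    exact le_abs_self b
  have h4 := (ENNReal.ofReal_le_ofReal_iff (by positivity)).1
    (h2.trans (ENNReal.ofReal_le_ofReal h3))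
  refine h4.trans ?_
  have h5 : kinetic (u : L2 ν) ≤ ∑ i, ‖posPart hV i u‖ ^ 2 := by
    rw [Fintype.sum_option]
    exact le_add_of_nonneg_left (by positivity)
  have : ‖(formDomain V).subtype u‖ = ‖(u : L2 ν)‖ := rfl
  rw [this]
  gcongr

/-- The form of the Hamiltonian is closed. -/
theorem mem_formDomain_of_tendsto (hV : AEStronglyMeasurable V volume) {u : ℕ → formDomain V}
    {x z : L2 ν} {y : Option (Fin ν) → L2 ν} (hx : Tendsto (fun n => (u n : L2 ν)) atTop (𝓝 x))
    (hz : Tendsto (fun n => sqrtNeg hV (u n)) atTop (𝓝 z))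
    (hy : ∀ i, Tendsto (fun n => posPart hV i (u n)) atTop (𝓝 (y i))) :
    ∃ w : formDomain V, (w : L2 ν) = x ∧ ∀ i, posPart hV i w = y i := by
  have h1 : ∀ i, HasWeakPartial i x (y (some i)) := fun i =>
    HasWeakPartial.of_tendsto (fun n => hasWeakPartial_weakPartial (u n).2.1 i) hx (hy (some i))
  have h2 : y none =ᵐ[volume] fun t => √(V t) • x t :=
    smul_ae_eq_of_tendsto (fun n => coeFn_sqrtPos hV (u n)) hx (hy none)
  have h3 : z =ᵐ[volume] fun t => √(-V t) • x t :=
    smul_ae_eq_of_tendsto (fun n => coeFn_sqrtNeg hV (u n)) hx hz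
  have hmem : x ∈ formDomain V := by
    refine ⟨fun i => ⟨_, h1 i⟩, (memLp_congr_ae ?_).2 ((Lp.memLp (y none)).add (Lp.memLp z))⟩
    filter_upwards [h2, h3] with t ht1 ht2
    rw [Pi.add_apply, ht1, ht2, sqrt_abs_eq, add_smul]
  refine ⟨⟨x, hmem⟩, rfl, fun i => ?_⟩
  match i with
  | none => exact Lp.ext ((coeFn_sqrtPos hV ⟨x, hmem⟩).trans h2.symm)
  | some i => exact (h1 i).weakPartial_eq

/-- Density of the form domain makes the relation `graph V` single-valued: a pair `(0, f)` in it has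
`f` orthogonal to the whole form domain. -/
theorem hamiltonian_graph (hV : LocallyIntegrable V) : (hamiltonian V).graph = graph V := by
  refine Submodule.toLinearPMap_graph_eq _ fun z hz hz1 => ?_
  refine eq_zero_of_orthogonal_formDomain hV fun v hv => ?_
  rw [← (hz.2 v hv).2, form, hz1]
  have h0 : (fun x => conj (v x) * ((V x : ℂ) * (0 : L2 ν) x)) =ᵐ[volume] fun _ => (0 : ℂ) := by
    filter_upwards [Lp.coeFn_zero ℂ 2 (volume : Measure (EuclideanSpace ℝ (Fin ν)))] with x hx
    rw [hx, Pi.zero_apply, mul_zero, mul_zero]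
  have hd : ∀ i, weakPartial i (0 : L2 ν) = 0 := fun i =>
    map_zero (partialMap i (sobolevH1 ν) le_rfl)
  rw [integral_congr_ae h0]
  simp [hd]

/-- The form domain of a form-bounded potential with the form norm is a Hilbert space, and the
Hamiltonian has a positive resolvent that factors through it. -/
theorem exists_formSpace_hamiltonian (hV : LocallyIntegrable V) (hb : NegPartFormBounded V) :
    ∃ (K : Type) (_ : NormedAddCommGroup K) (_ : InnerProductSpace ℂ K) (_ : CompleteSpace K)
      (c : ℝ) (j : K →L[ℂ] L2 ν), (∀ k, j k ∈ formDomain V) ∧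
        (∀ u ∈ formDomain V, ∃ k, j k = u) ∧
        (∀ k, ‖k‖ ^ 2 = energy V (j k) + c * ‖j k‖ ^ 2) ∧
        IsShiftedInverse (hamiltonian V) c (j ∘L ContinuousLinearMap.adjoint j) := by
  have hm := hV.aestronglyMeasurable
  obtain ⟨a, b, ha0, ha1, hab⟩ := hb
  obtain ⟨K, _, _, _, j, e, he, hj, hinner⟩ := exists_formSpace (J := (formDomain V).subtype)
    (N := sqrtNeg hm) (G := posPart hm) ha1 (Submodule.injective_subtype _)
    (norm_sqrtNeg_sq_le hm ha0 hab) fun u x z y hx hz hy => mem_formDomain_of_tendsto hm hx hz hy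
  set c : ℝ := |(|b|)| + 1
  have hform : ∀ k l : K, ⟪k, l⟫_ℂ = form V (j k) (j l) + c * ⟪j k, j l⟫_ℂ := fun k l => by
    rw [hinner, ← form_eq hm, hj, hj]
    rfl
  have hmem : ∀ k, j k ∈ formDomain V := fun k => by
    rw [hj]
    exact (e k).2
  have hsurj : ∀ u ∈ formDomain V, ∃ k, j k = u := fun u hu => by
    obtain ⟨k, hk⟩ := he ⟨u, hu⟩
    exact ⟨k, by rw [hj, hk]; rfl⟩
  refine ⟨K, _, _, inferInstance, c, j, hmem, hsurj, fun k => ?_, ?_, fun f => ?_, fun u => ?_⟩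
  · rw [norm_sq_eq_re_inner (𝕜 := ℂ), hform, ← re_form_self, norm_sq_eq_re_inner (𝕜 := ℂ) (j k)]
    simp only [RCLike.re_to_complex, Complex.add_re, Complex.re_ofReal_mul]
  · rw [ContinuousLinearMap.nonneg_iff_isPositive]
    exact ContinuousLinearMap.isPositive_self_comp_adjoint j
  -- For `u = j j* f` the defining property `⟨k, j* f⟩ = ⟨j k, f⟩` of the adjoint reads `form V (j
  -- k) u + c ⟨j k, u⟩ = ⟨j k, f⟩`, the weak form of `(A + c) u = f`.
  · have hg : ((j ∘L ContinuousLinearMap.adjoint j) f,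
        f - (c : ℂ) • (j ∘L ContinuousLinearMap.adjoint j) f) ∈ (hamiltonian V).graph := by
      rw [hamiltonian_graph hV]
      refine ⟨hmem _, fun v hv => ⟨integrable_conj_mul_potential hm ⟨v, hv⟩ ⟨_, hmem _⟩, ?_⟩⟩
      obtain ⟨k, rfl⟩ := hsurj v hv
      have := hform k (ContinuousLinearMap.adjoint j f)
      rw [ContinuousLinearMap.adjoint_inner_right] at this
      rw [inner_sub_right, inner_smul_right, this]
      simp
    obtain ⟨u, hu1, hu2⟩ := (LinearPMap.mem_graph_iff _).1 hg
    have hu : (u : L2 ν) = (j ∘L ContinuousLinearMap.adjoint j) f := hu1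
    have hd : (j ∘L ContinuousLinearMap.adjoint j) f ∈ (hamiltonian V).domain := hu ▸ u.2
    refine ⟨hd, ?_⟩
    have h2 : (⟨_, hd⟩ : (hamiltonian V).domain) = u := Subtype.ext hu.symm
    rw [h2, hu2, neg_smul, sub_neg_eq_add]
    exact sub_add_cancel _ _
  · have hg : ((u : L2 ν), hamiltonian V u) ∈ graph V := by
      rw [← hamiltonian_graph hV]
      exact LinearPMap.mem_graph _ u
    obtain ⟨k, hk⟩ := hsurj u hg.1
    rw [neg_smul, sub_neg_eq_add, ContinuousLinearMap.comp_apply, ← hk]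
    congr 1
    refine ext_inner_left ℂ fun l => ?_
    rw [ContinuousLinearMap.adjoint_inner_right, hform, inner_add_right, inner_smul_right, hk,
      (hg.2 _ (hmem l)).2]

end Hamiltonian

/-! ### Translations and integration by parts in `H¹`. -/

section Translation

variable {ν : ℕ}

/-- Translation of an `L²` function by a vector. -/
def translate (v : EuclideanSpace ℝ (Fin ν)) : L2 ν →ₗᵢ[ℂ] L2 ν :=
  Lp.compMeasurePreservingₗᵢ ℂ (fun x => x + v) (measurePreserving_add_right volume v)

theorem coeFn_translate (v : EuclideanSpace ℝ (Fin ν)) (u : L2 ν) :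
    translate v u =ᵐ[volume] fun x => u (x + v) :=
  Lp.coeFn_compMeasurePreserving u (measurePreserving_add_right volume v)

theorem translate_zero (u : L2 ν) : translate 0 u = u := by
  refine Lp.ext ((coeFn_translate 0 u).trans (.of_forall fun x => ?_))
  simp only [add_zero]

theorem continuous_translate_smul (v : EuclideanSpace ℝ (Fin ν)) (u : L2 ν) :
    Continuous fun t : ℝ => translate (t • v) u := by
  let g : ℝ → C(EuclideanSpace ℝ (Fin ν), EuclideanSpace ℝ (Fin ν)) := fun t =>
    ⟨fun x => x + t • v, by fun_prop⟩
  have hg : Continuous g := ContinuousMap.continuous_of_continuous_uncurry _ (by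
    change Continuous fun p : ℝ × EuclideanSpace ℝ (Fin ν) => p.2 + p.1 • v
    fun_prop)
  exact (continuous_const (y := u)).compMeasurePreservingLp hg
    (fun t => measurePreserving_add_right volume (t • v)) (by norm_num)

theorem integral_smul_translate (v : EuclideanSpace ℝ (Fin ν)) (u : L2 ν)
    (φ : EuclideanSpace ℝ (Fin ν) → ℝ) :
    ∫ x, φ x • translate v u x = ∫ x, φ (x - v) • u x := by
  rw [← integral_add_right_eq_self (fun x => φ (x - v) • u x) v]
  refine integral_congr_ae ?_
  filter_upwards [coeFn_translate v u] with x hx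
  rw [hx, add_sub_cancel_right]

/-- Moving the translation onto the smooth `φ` permits differentiation under the integral; the
definition of the weak derivative then returns the derivative to `u`. -/
theorem HasWeakPartial.hasDerivAt_integral {i : Fin ν} {u g : L2 ν} (h : HasWeakPartial i u g)
    {φ : EuclideanSpace ℝ (Fin ν) → ℝ} (hφ : ContDiff ℝ ∞ φ) (hc : HasCompactSupport φ) (t : ℝ) :
    HasDerivAt (fun s : ℝ => ∫ x, φ x • translate (s • EuclideanSpace.single i 1) u x)
      (∫ x, φ x • translate (t • EuclideanSpace.single i 1) g x) t := by
  set e : EuclideanSpace ℝ (Fin ν) := EuclideanSpace.single i 1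
  simp_rw [integral_smul_translate]
  have hshift : ∀ s : ℝ, ContDiff ℝ ∞ fun x => φ (x - s • e) := fun s =>
    hφ.comp (contDiff_id.sub contDiff_const)
  have hshiftc : ∀ s : ℝ, HasCompactSupport fun x => φ (x - s • e) := fun s =>
    hc.comp_homeomorph (Homeomorph.subRight (s • e))
  have hfd : ∀ (s : ℝ) (x : EuclideanSpace ℝ (Fin ν)),
      fderiv ℝ (fun x => φ (x - s • e)) x e = fderiv ℝ φ (x - s • e) e := fun s x => by
    rw [fderiv_comp_sub]
  have hval : ∫ x, φ (x - t • e) • g x = ∫ x, -(fderiv ℝ φ (x - t • e) e) • u x := by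
    have : ∫ x, fderiv ℝ (fun x => φ (x - t • e)) x e • u x = -∫ x, φ (x - t • e) • g x :=
      h _ (hshift t) (hshiftc t)
    simp only [hfd] at this
    simp only [neg_smul]
    rw [integral_neg, this, neg_neg]
  rw [hval]
  have hdcont : Continuous fun x => fderiv ℝ φ x e :=
    (hφ.continuous_fderiv (by simp)).clm_apply continuous_const
  obtain ⟨C, hC⟩ := (hc.fderiv_apply (𝕜 := ℝ) e).exists_bound_of_continuous hdcont
  -- This compact set contains the supports of all translates with `|s - t| ≤ 1`, so a multiple of
  -- `|u|` on it dominates.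
  set S : Set (EuclideanSpace ℝ (Fin ν)) :=
    (fun p : EuclideanSpace ℝ (Fin ν) × ℝ => p.1 + p.2 • e) ''
      (tsupport φ ×ˢ Set.Icc (t - 1) (t + 1)) with hS
  have hScomp : IsCompact S :=
    (hc.isCompact.prod isCompact_Icc).image (by fun_prop)
  refine (hasDerivAt_integral_of_dominated_loc_of_deriv_le (Metric.ball_mem_nhds t one_pos)
    (bound := S.indicator fun x => C * ‖u x‖)
    (F' := fun s x => -(fderiv ℝ φ (x - s • e) e) • u x)
    (.of_forall fun s => (integrable_test_smul u (hshift s).continuous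
      (hshiftc s)).aestronglyMeasurable)
    (integrable_test_smul u (hshift t).continuous (hshiftc t)) ?_ ?_ ?_ ?_).2
  · exact ((hdcont.comp (by fun_prop : Continuous fun x => x - t • e)).neg.aestronglyMeasurable).smul
      (Lp.aestronglyMeasurable u)
  · refine .of_forall fun x s hs => ?_
    rw [norm_smul, norm_neg]
    by_cases hx : x ∈ S
    · rw [Set.indicator_of_mem hx]
      gcongr
      exact hC _
    · have hx' : x - s • e ∉ tsupport φ := fun hmem => hx ⟨(x - s • e, s), ⟨hmem, by
        rw [Metric.mem_ball, Real.dist_eq, abs_lt] at hs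
        constructor <;> linarith [hs.1, hs.2]⟩, sub_add_cancel _ _⟩
      have h0 : fderiv ℝ φ (x - s • e) = 0 :=
        image_eq_zero_of_notMem_tsupport fun hm => hx' (tsupport_fderiv_subset ℝ hm)
      rw [Set.indicator_of_notMem hx, h0]
      simp
  · rw [integrable_indicator_iff hScomp.measurableSet]
    exact ((((Lp.memLp u).locallyIntegrable (by norm_num)).integrableOn_isCompact
      hScomp).norm.const_mul C)
  · refine .of_forall fun x s hs => ?_
    have h1 : HasDerivAt (fun s : ℝ => x - s • e) (-e) s := by
      simpa using ((hasDerivAt_id s).smul_const e).const_sub x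
    have h2 := ((hφ.differentiable (by simp) (x - s • e)).hasFDerivAt.comp_hasDerivAt s h1)
    rw [map_neg] at h2
    exact h2.smul_const (u x)

/-- A weak derivative in `L²` is the derivative of the group of translations. -/
theorem HasWeakPartial.hasDerivAt_translate {i : Fin ν} {u g : L2 ν} (h : HasWeakPartial i u g) :
    HasDerivAt (fun t : ℝ => translate (t • EuclideanSpace.single i 1) u) g 0 := by
  set e : EuclideanSpace ℝ (Fin ν) := EuclideanSpace.single i 1
  have hcont := continuous_translate_smul e g
  have hint : ∀ t, HasDerivAt (fun t => ∫ s in (0 : ℝ)..t, translate (s • e) g)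
      (translate (t • e) g) t := fun t => (hcont.integral_hasStrictDerivAt 0 t).hasDerivAt
  -- Paired with any test function, this difference has zero derivative in `t` and vanishes at `t =
  -- 0`. This upgrades the weak statement to norm differentiability, through the fundamental theorem
  -- of calculus for the norm-continuous orbit of `g`.
  have key : ∀ t : ℝ, translate (t • e) u - u - ∫ s in (0 : ℝ)..t, translate (s • e) g = 0 := by
    intro t
    have hae : ∀ᵐ x ∂volume,
        (translate (t • e) u - u - ∫ s in (0 : ℝ)..t, translate (s • e) g : L2 ν) x = 0 := by
      refine ae_eq_zero_of_integral_contDiff_smul_eq_zero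
        ((Lp.memLp _).locallyIntegrable (by norm_num)) fun φ hφ hc => ?_
      obtain ⟨Φ, -, hΦ⟩ := exists_inner_eq_integral_smul hφ.continuous hc
      rw [hΦ]
      have hd : ∀ t : ℝ, HasDerivAt (fun t => ⟪Φ, translate (t • e) u - u -
          ∫ s in (0 : ℝ)..t, translate (s • e) g⟫_ℂ) 0 t := fun t => by
        have h1 := h.hasDerivAt_integral hφ hc t
        simp only [hΦ] at h1
        have h2 := (innerSL ℂ Φ).restrictScalars ℝ |>.hasFDerivAt.comp_hasDerivAt t (hint t)
        have h3 := (h1.sub_const ⟪Φ, u⟫_ℂ).sub h2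
        have h4 : ⟪Φ, translate (t • e) g⟫_ℂ -
            ((innerSL ℂ Φ).restrictScalars ℝ) (translate (t • e) g) = 0 := sub_self _
        rw [h4] at h3
        refine h3.congr_of_eventuallyEq (.of_forall fun s => ?_)
        simp only [inner_sub_right]
        rfl
      have hconst := is_const_of_deriv_eq_zero (fun t => (hd t).differentiableAt)
        (fun t => (hd t).deriv) t 0
      rw [hconst]
      simp [translate_zero]
    refine Lp.ext ?_
    filter_upwards [hae, Lp.coeFn_zero ℂ 2 (volume : Measure (EuclideanSpace ℝ (Fin ν)))]
      with x h1 h2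
    rw [h1, h2, Pi.zero_apply]
  have hfun : (fun t : ℝ => translate (t • e) u) =
      fun t => u + ∫ s in (0 : ℝ)..t, translate (s • e) g := by
    ext1 t
    have := key t
    rw [sub_sub, sub_eq_zero] at this
    exact this
  rw [hfun]
  have := (hint 0).const_add u
  rwa [zero_smul, translate_zero] at this

/-- Multiplication by a bounded measurable function as a bounded operator on `L²`. -/
theorem exists_mulOperator {φ : EuclideanSpace ℝ (Fin ν) → ℝ} (hφ : AEStronglyMeasurable φ volume)
    {M : ℝ} (hM : ∀ x, |φ x| ≤ M) :
    ∃ m : L2 ν →L[ℂ] L2 ν, ∀ u, m u =ᵐ[volume] fun x => φ x • u x := by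
  have hmem : ∀ u ∈ (⊤ : Submodule ℂ (L2 ν)), MemLp (fun x => φ x • u x) 2 volume := fun u _ =>
    (Lp.memLp u).of_le_mul (c := M) (hφ.smul (Lp.aestronglyMeasurable u)) (.of_forall fun x => by
      rw [norm_smul, Real.norm_eq_abs]
      gcongr
      exact hM x)
  let l : L2 ν →ₗ[ℂ] L2 ν := mulMap φ ⊤ hmem ∘ₗ (Submodule.topEquiv (R := ℂ) (M := L2 ν)).symm.toLinearMap
  have hl : ∀ u, l u =ᵐ[volume] fun x => φ x • u x := fun u =>
    coeFn_mulMap hmem (Submodule.topEquiv.symm u)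
  refine ⟨l.mkContinuous M fun u => ?_, hl⟩
  refine Lp.norm_le_mul_norm_of_ae_le_mul ?_
  filter_upwards [hl u] with x hx
  rw [hx, norm_smul, Real.norm_eq_abs]
  gcongr
  exact hM x

/-- Integration by parts against the square of a function in `H¹`. -/
theorem HasWeakPartial.integral_lineDeriv_mul_norm_sq {i : Fin ν} {u g : L2 ν}
    (h : HasWeakPartial i u g) {φ φ' : EuclideanSpace ℝ (Fin ν) → ℝ} {C : NNReal} {M : ℝ}
    (hφ : LipschitzWith C φ) (hM : ∀ x, |φ x| ≤ M) (hφ' : AEStronglyMeasurable φ' volume)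
    (hd : ∀ᵐ x, HasLineDerivAt ℝ φ (φ' x) x (EuclideanSpace.single i 1)) :
    (Integrable fun x => φ' x * ‖u x‖ ^ 2) ∧
      ∫ x, φ' x * ‖u x‖ ^ 2 = -2 * ∫ x, φ x * (conj (u x) * g x).re := by
  set e : EuclideanSpace ℝ (Fin ν) := EuclideanSpace.single i 1
  have hφm : AEStronglyMeasurable φ volume := hφ.continuous.aestronglyMeasurable
  obtain ⟨m, hm⟩ := exists_mulOperator hφm hM
  have hu2 : Integrable fun x => ‖u x‖ ^ 2 :=
    (memLp_two_iff_integrable_sq_norm (Lp.aestronglyMeasurable _)).1 (Lp.memLp _)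
  -- One function of `t` is written in two ways, with the translation on `u` or on `φ`. The first is
  -- differentiable because `u` has a weak derivative, the second because `φ` is Lipschitz; equating
  -- the derivatives at `0` gives the identity.
  have hshift : ∀ t : ℝ, (⟪translate ((-t) • e) u, m (translate ((-t) • e) u)⟫_ℂ).re =
      ∫ x, φ (x + t • e) * ‖u x‖ ^ 2 := by
    intro t
    rw [L2.inner_def, ← integral_add_right_eq_self (fun x => φ (x + t • e) * ‖u x‖ ^ 2)
      ((-t) • e)]
    have := integral_re (𝕜 := ℂ) (L2.integrable_inner (𝕜 := ℂ) (translate ((-t) • e) u)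
      (m (translate ((-t) • e) u)))
    refine this.symm.trans (integral_congr_ae ?_)
    filter_upwards [hm (translate ((-t) • e) u), coeFn_translate ((-t) • e) u] with x h1 h2
    rw [h1, h2, neg_smul, neg_add_cancel_right, ← Complex.coe_smul, inner_smul_right,
      RCLike.re_to_complex, Complex.re_ofReal_mul]
    congr 1
    exact (norm_sq_eq_re_inner (𝕜 := ℂ) (u (x + -(t • e)))).symm
  have hder1 : HasDerivAt (fun t : ℝ => (⟪translate ((-t) • e) u,
      m (translate ((-t) • e) u)⟫_ℂ).re) (⟪u, m (-g)⟫_ℂ + ⟪-g, m u⟫_ℂ).re 0 := by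
    have h0 : HasDerivAt (fun t : ℝ => translate ((-t) • e) u) (-g) 0 := by
      have h1 := h.hasDerivAt_translate
      rw [← neg_zero] at h1
      have := h1.scomp (0 : ℝ) (hasDerivAt_neg (0 : ℝ))
      rwa [neg_one_smul] at this
    have h1 : HasDerivAt (fun t : ℝ => m (translate ((-t) • e) u)) (m (-g)) 0 :=
      (m.restrictScalars ℝ).hasFDerivAt.comp_hasDerivAt 0 h0
    have h2 := h0.inner ℂ h1
    simp only [neg_zero, zero_smul, translate_zero] at h2
    exact Complex.reCLM.hasFDerivAt.comp_hasDerivAt 0 h2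
  have hder2 := hasDerivAt_integral_of_dominated_loc_of_lip (μ := volume) (𝕜 := ℝ) (x₀ := 0)
    (F := fun t x => φ (x + t • e) * ‖u x‖ ^ 2) (F' := fun x => φ' x * ‖u x‖ ^ 2)
    (bound := fun x => C * ‖e‖ * ‖u x‖ ^ 2) (s := Set.univ) univ_mem
    (.of_forall fun t => (hφ.continuous.comp (by fun_prop :
      Continuous fun x => x + t • e)).aestronglyMeasurable.mul hu2.aestronglyMeasurable)
    (by
      refine hu2.bdd_mul (c := M) ?_ (.of_forall fun x => hM _)
      simpa using hφm)
    (hφ'.mul hu2.aestronglyMeasurable)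
    (.of_forall fun x => LipschitzOnWith.of_dist_le_mul fun s _ t _ => by
      rw [Real.coe_nnabs, abs_of_nonneg (by positivity), Real.dist_eq, ← sub_mul, abs_mul,
        abs_of_nonneg (sq_nonneg ‖u x‖)]
      have := hφ.dist_le_mul (x + s • e) (x + t • e)
      rw [Real.dist_eq, dist_add_left, dist_eq_norm, ← sub_smul, norm_smul, ← dist_eq_norm] at this
      calc _ ≤ (C * (dist s t * ‖e‖)) * ‖u x‖ ^ 2 := by gcongr
        _ = _ := by ring)
    (hu2.const_mul _)
    (hd.mono fun x hx => hx.mul_const _)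
  refine ⟨hder2.1, ?_⟩
  have heq := hder2.2.unique (hder1.congr_of_eventuallyEq (.of_forall fun t => (hshift t).symm))
  rw [heq]
  have hug : ∀ v w : L2 ν, (⟪v, m w⟫_ℂ).re = ∫ x, φ x * (conj (v x) * w x).re := fun v w => by
    rw [L2.inner_def]
    refine (integral_re (𝕜 := ℂ) (L2.integrable_inner (𝕜 := ℂ) v (m w))).symm.trans
      (integral_congr_ae ?_)
    filter_upwards [hm w] with x hx
    rw [hx, ← Complex.coe_smul, inner_smul_right, RCLike.re_to_complex, Complex.re_ofReal_mul,
      RCLike.inner_apply, mul_comm (w x)]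
  rw [map_neg, inner_neg_right, inner_neg_left, Complex.add_re, Complex.neg_re, Complex.neg_re, hug,
    hug]
  have : ∫ x, φ x * (conj (g x) * u x).re = ∫ x, φ x * (conj (u x) * g x).re := by
    refine integral_congr_ae (.of_forall fun x => ?_)
    simp only [Complex.mul_re, Complex.conj_re, Complex.conj_im]
    ring
  rw [this]
  ring

end Translation

/-! ### Lipschitz properties of the vector field, and cutoff functions. -/

section RegularField

variable {ν : ℕ} {W : EuclideanSpace ℝ (Fin ν) → EuclideanSpace ℝ (Fin ν)}

/-- A product of a Lipschitz function of compact support with a Lipschitz function is Lipschitz. -/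
theorem exists_lipschitzWith_mul {X : Type*} [PseudoMetricSpace X] {χ w : X → ℝ} {C D : NNReal}
    (hχ : LipschitzWith C χ) (hc : HasCompactSupport χ) (hw : LipschitzWith D w) :
    ∃ L, LipschitzWith L fun x => χ x * w x := by
  obtain ⟨M, hM⟩ := hc.exists_bound_of_continuous hχ.continuous
  obtain ⟨B, hB⟩ := hc.isCompact.exists_bound_of_continuousOn hw.continuous.continuousOn
  have hM' : ∀ x, |χ x| ≤ max M 0 := fun x => (hM x).trans (le_max_left _ _)
  -- `w` is bounded only on the compact support of `χ`, so it is evaluated at the point known to lie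
  -- there.
  have hkey : ∀ x y, x ∈ tsupport χ →
      |χ x * w x - χ y * w y| ≤ (C * max B 0 + max M 0 * D) * dist x y := fun x y hx => by
    have h1 : |χ x - χ y| ≤ C * dist x y := hχ.dist_le_mul x y
    have h2 : |w x - w y| ≤ D * dist x y := hw.dist_le_mul x y
    have h3 : |w x| ≤ max B 0 := (hB x hx).trans (le_max_left _ _)
    calc |χ x * w x - χ y * w y| = |(χ x - χ y) * w x + χ y * (w x - w y)| := by ring_nf
      _ ≤ |χ x - χ y| * |w x| + |χ y| * |w x - w y| := by
        rw [← abs_mul, ← abs_mul]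
        exact abs_add_le _ _
      _ ≤ (C * dist x y) * max B 0 + max M 0 * (D * dist x y) := by
        gcongr
        exact hM' y
      _ = _ := by ring
  refine ⟨C * B.toNNReal + M.toNNReal * D, LipschitzWith.of_dist_le_mul fun x y => ?_⟩
  rw [Real.dist_eq]
  push_cast
  rw [Real.coe_toNNReal', Real.coe_toNNReal']
  by_cases hx : x ∈ tsupport χ
  · exact hkey x y hx
  by_cases hy : y ∈ tsupport χ
  · rw [abs_sub_comm, dist_comm]
    exact hkey y x hy
  rw [image_eq_zero_of_notMem_tsupport hx, image_eq_zero_of_notMem_tsupport hy]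
  simp only [zero_mul, sub_self, abs_zero]
  positivity

theorem measurable_divergence (W : EuclideanSpace ℝ (Fin ν) → EuclideanSpace ℝ (Fin ν)) :
    Measurable (divergence W) := by
  refine Finset.measurable_sum _ fun i _ => ?_
  have h1 := measurable_fderiv_apply_const ℝ W (EuclideanSpace.single i 1)
  exact (by fun_prop : Measurable fun v : EuclideanSpace ℝ (Fin ν) => v i).comp h1

/-- What is used of the vector field: it is continuous, differentiable almost everywhere and
locally Lipschitz. -/
structure IsLocallyLipschitzField (W : EuclideanSpace ℝ (Fin ν) → EuclideanSpace ℝ (Fin ν)) :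
    Prop where
  continuous : Continuous W
  ae_differentiableAt : ∀ᵐ x, DifferentiableAt ℝ W x
  lipschitz : ∀ χ : EuclideanSpace ℝ (Fin ν) → ℝ, ContDiff ℝ ∞ χ → HasCompactSupport χ →
    ∀ i, ∃ L, LipschitzWith L fun x => χ x * W x i

theorem isLocallyLipschitzField_of_contDiff (hW : ContDiff ℝ 1 W) : IsLocallyLipschitzField W := by
  refine ⟨hW.continuous, .of_forall fun x => hW.differentiable (by simp) x, fun χ hχ hc i => ?_⟩
  have hWi : ContDiff ℝ 1 fun x => W x i := by fun_prop
  exact ContDiff.lipschitzWith_of_hasCompactSupport (n := 1) hc.mul_right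
    ((hχ.of_le (by simp)).mul hWi) (by simp)

/-- In one dimension the divergence is the derivative of `W`, off a countable set. Since `W` is
continuous, the fundamental theorem of calculus tolerates these exceptions and makes the bound on
the divergence a Lipschitz constant. -/
theorem lipschitzWith_of_isPiecewiseC1
    {W : EuclideanSpace ℝ (Fin 1) → EuclideanSpace ℝ (Fin 1)}
    (hW : IsPiecewiseC1 fun t : ℝ => W (EuclideanSpace.single 0 t)) {C : ℝ}
    (hC : ∀ x, |divergence W x| ≤ C) : LipschitzWith C.toNNReal W := by
  obtain ⟨hcont, S, hS, hdiff, -⟩ := hW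
  have hC0 : 0 ≤ C := (abs_nonneg _).trans (hC 0)
  have hScount : S.Countable := by
    have : S ⊆ ⋃ n : ℕ, S ∩ Set.Icc (-(n : ℝ)) n := fun t ht => by
      obtain ⟨n, hn⟩ := exists_nat_ge |t|
      exact Set.mem_iUnion.2 ⟨n, ht, abs_le.1 hn⟩
    exact (Set.countable_iUnion fun n : ℕ => (hS n).countable).mono this
  have hx0 : ∀ x : EuclideanSpace ℝ (Fin 1), EuclideanSpace.single 0 (x 0) = x := fun x => by
    ext i
    rw [Subsingleton.elim i 0]
    simp
  have hsingle : ∀ t : ℝ, (EuclideanSpace.single 0 t : EuclideanSpace ℝ (Fin 1)) =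
      t • EuclideanSpace.single 0 1 := fun t => by
    ext i
    rw [Subsingleton.elim i 0]
    simp
  have hWdiff : ∀ t ∉ S, DifferentiableAt ℝ W (EuclideanSpace.single 0 t) := fun t ht => by
    have h1 : DifferentiableAt ℝ (fun t : ℝ => W (EuclideanSpace.single 0 t))
        ((EuclideanSpace.single 0 t : EuclideanSpace ℝ (Fin 1)) 0) := by
      simpa using (hdiff t ht).differentiableAt (by simp)
    have h2 : DifferentiableAt ℝ (fun x : EuclideanSpace ℝ (Fin 1) => x 0)
      (EuclideanSpace.single 0 t) := by fun_prop
    have h3 := DifferentiableAt.comp (g := fun t : ℝ => W (EuclideanSpace.single 0 t))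
      (f := fun x : EuclideanSpace ℝ (Fin 1) => x 0) (EuclideanSpace.single 0 t) h1 h2
    refine h3.congr_of_eventuallyEq (.of_forall fun x => ?_)
    simp only [Function.comp, hx0]
  have hderiv : ∀ t ∉ S, HasDerivAt (fun t : ℝ => W (EuclideanSpace.single 0 t) 0)
      (divergence W (EuclideanSpace.single 0 t)) t := fun t ht => by
    have h1 : HasDerivAt (fun t : ℝ => (EuclideanSpace.single 0 t : EuclideanSpace ℝ (Fin 1)))
        (EuclideanSpace.single 0 1) t := by
      have := (hasDerivAt_id t).smul_const (EuclideanSpace.single (0 : Fin 1) (1 : ℝ))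
      rw [one_smul] at this
      exact this.congr_of_eventuallyEq (.of_forall hsingle)
    have h2 := (hWdiff t ht).hasFDerivAt.comp_hasDerivAt t h1
    have h3 := (EuclideanSpace.proj 0 : EuclideanSpace ℝ (Fin 1) →L[ℝ] ℝ).hasFDerivAt
      |>.comp_hasDerivAt t h2
    rw [divergence, Fin.sum_univ_one]
    exact h3
  have hmeas : Measurable fun t : ℝ =>
      divergence W (EuclideanSpace.single 0 t : EuclideanSpace ℝ (Fin 1)) := by
    refine (measurable_divergence W).comp ?_
    rw [funext hsingle]
    fun_prop
  have hg : ∀ a b : ℝ, |W (EuclideanSpace.single 0 b) 0 - W (EuclideanSpace.single 0 a) 0| ≤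
      C * |b - a| := fun a b => by
    have hi : IntervalIntegrable (fun t : ℝ =>
        divergence W (EuclideanSpace.single 0 t : EuclideanSpace ℝ (Fin 1))) volume a b :=
      (intervalIntegrable_const (c := C)).mono_fun hmeas.aestronglyMeasurable
        (.of_forall fun t => (hC _).trans (le_abs_self C))
    have h1 := integral_eq_of_hasDerivAt_off_countable
      (fun t : ℝ => W (EuclideanSpace.single 0 t) 0)
      (fun t => divergence W (EuclideanSpace.single 0 t)) (a := a) (b := b) hScount
      ((EuclideanSpace.proj 0 : EuclideanSpace ℝ (Fin 1) →L[ℝ] ℝ).continuous.comp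
        hcont).continuousOn (fun t ht => hderiv t ht.2) hi
    rw [← h1]
    exact intervalIntegral.norm_integral_le_of_norm_le_const (f := fun t : ℝ =>
      divergence W (EuclideanSpace.single 0 t : EuclideanSpace ℝ (Fin 1))) fun t _ => hC _
  refine LipschitzWith.of_dist_le_mul fun x y => ?_
  rw [Real.coe_toNNReal _ hC0, EuclideanSpace.dist_eq, EuclideanSpace.dist_eq]
  rw [Fin.sum_univ_one, Fin.sum_univ_one, Real.sqrt_sq dist_nonneg, Real.sqrt_sq dist_nonneg,
    Real.dist_eq, Real.dist_eq]
  have := hg (y 0) (x 0)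
  rwa [hx0, hx0] at this

theorem IsRegularField.isLocallyLipschitzField (hW : IsRegularField W)
    (hdiv : ∃ C : ℝ, ∀ x, |divergence W x| ≤ C) : IsLocallyLipschitzField W := by
  rcases hW with hW | ⟨rfl, hW⟩
  · exact isLocallyLipschitzField_of_contDiff hW
  · obtain ⟨C, hC⟩ := hdiv
    have hL := lipschitzWith_of_isPiecewiseC1 (hW 0) hC
    refine ⟨hL.continuous, hL.ae_differentiableAt, fun χ hχ hc i => ?_⟩
    obtain ⟨D, hD⟩ := ContDiff.lipschitzWith_of_hasCompactSupport hc hχ (by simp)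
    refine exists_lipschitzWith_mul hD hc (w := fun x => W x i) (D := C.toNNReal)
      (LipschitzWith.of_dist_le_mul fun x y => ?_)
    refine le_trans ?_ (hL.dist_le_mul x y)
    rw [dist_eq_norm, dist_eq_norm]
    exact PiLp.norm_apply_le (W x - W y) i

/-- Smooth cutoff functions that tend to one, with gradients that tend to zero. -/
theorem exists_cutoff_sequence (ν : ℕ) : ∃ (χ : ℕ → EuclideanSpace ℝ (Fin ν) → ℝ) (C : ℝ),
    (∀ n, ContDiff ℝ ∞ (χ n)) ∧ (∀ n, HasCompactSupport (χ n)) ∧ (∀ n x, |χ n x| ≤ 1) ∧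
      (∀ x, Tendsto (fun n => χ n x) atTop (𝓝 1)) ∧ (∀ n x, ‖fderiv ℝ (χ n) x‖ ≤ C) ∧
        ∀ x, Tendsto (fun n => fderiv ℝ (χ n) x) atTop (𝓝 0) := by
  let b : ContDiffBump (0 : EuclideanSpace ℝ (Fin ν)) := ⟨1, 2, one_pos, one_lt_two⟩
  obtain ⟨C, hC⟩ := (b.hasCompactSupport.fderiv ℝ).exists_bound_of_continuous
    (b.contDiff.continuous_fderiv (n := 1) (by simp))
  have hC0 : 0 ≤ C := (norm_nonneg _).trans (hC 0)
  let r : ℕ → ℝ := fun n => ((n : ℝ) + 1)⁻¹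
  have hr0 : ∀ n, 0 < r n := fun n => by positivity
  have hr1 : ∀ n, r n ≤ 1 := fun n => inv_le_one_of_one_le₀ (by simp)
  have hr : Tendsto r atTop (𝓝 0) := by
    simpa [r] using tendsto_one_div_add_atTop_nhds_zero_nat (𝕜 := ℝ)
  have hfd : ∀ n x, fderiv ℝ (fun x => b (r n • x)) x = r n • fderiv ℝ b (r n • x) := fun n x => by
    have := fderiv_comp_smul (𝕜 := ℝ) (f := (b : EuclideanSpace ℝ (Fin ν) → ℝ)) (r n) (x := x)
    exact this
  refine ⟨fun n x => b (r n • x), C, fun n => b.contDiff.comp (contDiff_const_smul _), fun n =>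
    b.hasCompactSupport.comp_homeomorph (Homeomorph.smulOfNeZero (r n) (hr0 n).ne'), fun n x => ?_,
    fun x => ?_, fun n x => ?_, fun x => ?_⟩
  · rw [abs_of_nonneg b.nonneg]
    exact b.le_one
  · have h1 : Tendsto (fun n => r n • x) atTop (𝓝 0) := by simpa using hr.smul_const x
    have h2 : b 0 = 1 := b.one_of_mem_closedBall (by simp [b])
    rw [← h2]
    exact b.continuous.continuousAt.tendsto.comp h1
  · rw [hfd, norm_smul, Real.norm_of_nonneg (hr0 n).le]
    calc r n * ‖fderiv ℝ b (r n • x)‖ ≤ 1 * C := by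
          gcongr
          · exact hr1 n
          · exact hC _
      _ = C := one_mul C
  · have h1 : Tendsto (fun n => r n * C) atTop (𝓝 0) := by simpa using hr.mul_const C
    refine squeeze_zero_norm (fun n => ?_) h1
    rw [hfd, norm_smul, Real.norm_of_nonneg (hr0 n).le]
    gcongr
    exact hC _

end RegularField

/-! ### The divergence identity and the form inequality. -/

section FormInequality

variable {ν : ℕ} {W : EuclideanSpace ℝ (Fin ν) → EuclideanSpace ℝ (Fin ν)}

theorem integrable_norm_sq (u : L2 ν) : Integrable fun x => ‖u x‖ ^ 2 :=
  (memLp_two_iff_integrable_sq_norm (Lp.aestronglyMeasurable _)).1 (Lp.memLp _)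

theorem norm_sq_eq_integral (u : L2 ν) : ‖u‖ ^ 2 = ∫ x, ‖u x‖ ^ 2 := by
  rw [norm_sq_eq_re_inner (𝕜 := ℂ), L2.inner_def, ← integral_re (L2.integrable_inner _ _)]
  refine integral_congr_ae (.of_forall fun x => ?_)
  exact (norm_sq_eq_re_inner (𝕜 := ℂ) (u x)).symm

theorem integrable_re_conj_mul (w g : L2 ν) : Integrable fun x => (conj (w x) * g x).re := by
  refine (L2.integrable_inner (𝕜 := ℂ) w g).re.congr (.of_forall fun x => ?_)
  simp only [RCLike.inner_apply, RCLike.re_to_complex, mul_comm]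

theorem re_inner_eq_integral (w g : L2 ν) :
    (⟪w, g⟫_ℂ).re = ∫ x, (conj (w x) * g x).re := by
  rw [L2.inner_def]
  refine (integral_re (𝕜 := ℂ) (L2.integrable_inner (𝕜 := ℂ) w g)).symm.trans
    (integral_congr_ae (.of_forall fun x => ?_))
  simp only [RCLike.inner_apply, RCLike.re_to_complex, mul_comm]

/-- The divergence theorem `∫ (∇·W) |u|² = -2 Re ∫ W ū ∇u`. -/
theorem integral_divergence_mul_norm_sq (hW : IsLocallyLipschitzField W) {C : ℝ}
    (hdiv : ∀ x, |divergence W x| ≤ C) {u : L2 ν} (hu : u ∈ sobolevH1 ν)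
    (hWu : Integrable fun x => ‖W x‖ ^ 2 * ‖u x‖ ^ 2) {w : Fin ν → L2 ν}
    (hw : ∀ i, w i =ᵐ[volume] fun x => W x i • u x) :
    ∫ x, divergence W x * ‖u x‖ ^ 2 = -2 * ∑ i, (⟪w i, weakPartial i u⟫_ℂ).re := by
  obtain ⟨χ, D, hχ, hχc, hχ1, hχlim, hχD, hχlim'⟩ := exists_cutoff_sequence ν
  have hD : 0 ≤ D := (norm_nonneg _).trans (hχD 0 0)
  have hu2 := integrable_norm_sq u
  have hWi : ∀ i, Continuous fun x => W x i := fun i =>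
    (EuclideanSpace.proj i : EuclideanSpace ℝ (Fin ν) →L[ℝ] ℝ).continuous.comp hW.continuous
  have hmeas : ∀ i, Measurable fun x => fderiv ℝ W x (EuclideanSpace.single i 1) i := fun i =>
    (EuclideanSpace.proj i : EuclideanSpace ℝ (Fin ν) →L[ℝ] ℝ).measurable.comp
      (measurable_fderiv_apply_const ℝ W (EuclideanSpace.single i 1))
  have hχd : ∀ n i, Continuous fun x => fderiv ℝ (χ n) x (EuclideanSpace.single i 1) :=
    fun n i => ((hχ n).continuous_fderiv (by simp)).clm_apply continuous_const
  -- The partial derivative `∂ᵢ (χₙ Wᵢ)`, valid wherever `W` is differentiable. The cutoff makes `χₙ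
  -- Wᵢ` bounded and globally Lipschitz.
  let φ' : ℕ → Fin ν → EuclideanSpace ℝ (Fin ν) → ℝ := fun n i x =>
    χ n x * fderiv ℝ W x (EuclideanSpace.single i 1) i +
      W x i * fderiv ℝ (χ n) x (EuclideanSpace.single i 1)
  have hparts : ∀ n i, (Integrable fun x => φ' n i x * ‖u x‖ ^ 2) ∧ ∫ x, φ' n i x * ‖u x‖ ^ 2 =
      -2 * ∫ x, χ n x * W x i * (conj (u x) * weakPartial i u x).re := by
    intro n i
    obtain ⟨L, hL⟩ := hW.lipschitz (χ n) (hχ n) (hχc n) i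
    obtain ⟨M, hM⟩ := (HasCompactSupport.mul_right (f' := fun x => W x i)
      (hχc n)).exists_bound_of_continuous ((hχ n).continuous.mul (hWi i))
    refine (hasWeakPartial_weakPartial hu i).integral_lineDeriv_mul_norm_sq hL hM
      (((hχ n).continuous.aestronglyMeasurable.mul (hmeas i).aestronglyMeasurable).add
        ((hWi i).mul (hχd n i)).aestronglyMeasurable) ?_
    filter_upwards [hW.ae_differentiableAt] with x hx
    have h1 : HasFDerivAt (fun x => W x i)
        ((EuclideanSpace.proj i : EuclideanSpace ℝ (Fin ν) →L[ℝ] ℝ).comp (fderiv ℝ W x)) x :=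
      (EuclideanSpace.proj i : EuclideanSpace ℝ (Fin ν) →L[ℝ] ℝ).hasFDerivAt.comp x hx.hasFDerivAt
    have h2 := ((hχ n).differentiable (by simp) x).hasFDerivAt.mul h1
    exact h2.hasLineDerivAt _
  have hsum : ∀ n, ∫ x, ∑ i, φ' n i x * ‖u x‖ ^ 2 =
      -2 * ∑ i, ∫ x, χ n x * W x i * (conj (u x) * weakPartial i u x).re := fun n => by
    rw [integral_finsetSum _ fun i _ => (hparts n i).1, Finset.mul_sum]
    exact Finset.sum_congr rfl fun i _ => (hparts n i).2
  have hlhs : Tendsto (fun n => ∫ x, ∑ i, φ' n i x * ‖u x‖ ^ 2) atTop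
      (𝓝 (∫ x, divergence W x * ‖u x‖ ^ 2)) := by
    refine tendsto_integral_of_dominated_convergence
      -- The gradient of the cutoff produces a term linear in `‖W x‖`, which `‖W x‖ ≤ 1 + ‖W x‖ ^ 2`
      -- reduces to the two integrable weights.
      (fun x => (C + ν * D) * ‖u x‖ ^ 2 + ν * D * (‖W x‖ ^ 2 * ‖u x‖ ^ 2))
      (fun n => (integrable_finsetSum _ fun i _ => (hparts n i).1).aestronglyMeasurable)
      ((hu2.const_mul _).add (hWu.const_mul _)) (fun n => .of_forall fun x => ?_)
      (.of_forall fun x => ?_)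
    · have h1 : ∑ i, φ' n i x * ‖u x‖ ^ 2 = (χ n x * divergence W x +
          ∑ i, W x i * fderiv ℝ (χ n) x (EuclideanSpace.single i 1)) * ‖u x‖ ^ 2 := by
        rw [← Finset.sum_mul, Finset.sum_add_distrib, divergence, Finset.mul_sum]
      have h2 : |∑ i, W x i * fderiv ℝ (χ n) x (EuclideanSpace.single i 1)| ≤ ν * (‖W x‖ * D) := by
        refine (Finset.abs_sum_le_sum_abs _ _).trans ?_
        refine (Finset.sum_le_card_nsmul _ _ (‖W x‖ * D) fun i _ => ?_).trans_eq (by simp)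
        rw [abs_mul]
        have h3 : |W x i| ≤ ‖W x‖ := PiLp.norm_apply_le (W x) i
        have h4 : |fderiv ℝ (χ n) x (EuclideanSpace.single i 1)| ≤ D := by
          refine ((fderiv ℝ (χ n) x).le_opNorm _).trans ?_
          rw [PiLp.norm_single, norm_one, mul_one]
          exact hχD n x
        gcongr
      have h5 : |χ n x * divergence W x| ≤ C := by
        rw [abs_mul]
        calc |χ n x| * |divergence W x| ≤ 1 * C := by
              gcongr
              · exact hχ1 n x
              · exact hdiv x
          _ = C := one_mul C
      have h6 : ‖W x‖ ≤ 1 + ‖W x‖ ^ 2 := by nlinarith [sq_nonneg (‖W x‖ - 1)]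
      rw [h1, Real.norm_eq_abs, abs_mul, abs_of_nonneg (sq_nonneg ‖u x‖)]
      calc _ ≤ (C + ν * ((1 + ‖W x‖ ^ 2) * D)) * ‖u x‖ ^ 2 := by
            gcongr
            refine (abs_add_le _ _).trans (add_le_add h5 (h2.trans ?_))
            gcongr
        _ = _ := by ring
    · have h1 : Tendsto (fun n => ∑ i, φ' n i x * ‖u x‖ ^ 2) atTop
          (𝓝 (∑ i, (1 * fderiv ℝ W x (EuclideanSpace.single i 1) i +
            W x i * (0 : EuclideanSpace ℝ (Fin ν) →L[ℝ] ℝ) (EuclideanSpace.single i 1)) *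
              ‖u x‖ ^ 2)) := by
        refine tendsto_finsetSum _ fun i _ => Tendsto.mul_const _ ?_
        refine ((hχlim x).mul_const _).add (Tendsto.const_mul _ ?_)
        exact ((ContinuousLinearMap.apply ℝ ℝ (EuclideanSpace.single i 1)).continuous.tendsto
          (0 : EuclideanSpace ℝ (Fin ν) →L[ℝ] ℝ)).comp (hχlim' x)
      simpa [divergence, Finset.sum_mul] using h1
  have hrhs : Tendsto (fun n => -2 * ∑ i, ∫ x, χ n x * W x i *
      (conj (u x) * weakPartial i u x).re) atTop
        (𝓝 (-2 * ∑ i, (⟪w i, weakPartial i u⟫_ℂ).re)) := by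
    refine Tendsto.const_mul _ (tendsto_finsetSum _ fun i _ => ?_)
    rw [re_inner_eq_integral]
    have hae : ∀ᵐ x, (conj (w i x) * weakPartial i u x).re =
        W x i * (conj (u x) * weakPartial i u x).re := by
      filter_upwards [hw i] with x hx
      rw [hx, Complex.real_smul, map_mul, Complex.conj_ofReal, mul_assoc, Complex.re_ofReal_mul]
    have hint := integrable_re_conj_mul (w i) (weakPartial i u)
    have hg : AEStronglyMeasurable (fun x => (conj (u x) * weakPartial i u x).re) volume :=
      (integrable_re_conj_mul u (weakPartial i u)).aestronglyMeasurable
    refine tendsto_integral_of_dominated_convergence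
      (fun x => |(conj (w i x) * weakPartial i u x).re|)
      (fun n => ((hχ n).continuous.mul (hWi i)).aestronglyMeasurable.mul hg) hint.abs
      (fun n => ?_) ?_
    · filter_upwards [hae] with x hx
      rw [hx, mul_assoc, Real.norm_eq_abs, abs_mul]
      exact mul_le_of_le_one_left (abs_nonneg _) (hχ1 n x)
    · filter_upwards [hae] with x hx
      rw [hx]
      have := (hχlim x).mul_const (W x i * (conj (u x) * weakPartial i u x).re)
      rw [one_mul] at this
      simpa only [mul_assoc] using this
  exact tendsto_nhds_unique hlhs (hrhs.congr fun n => (hsum n).symm)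

/-- The inequality `∫ (∇·W) |u|² + 2 ∫ |W|² |u|² ≥ -½ ‖∇u‖²`, from `‖∇u - 2 W u‖² ≥ 0`. -/
theorem integral_divergence_ge (hW : IsLocallyLipschitzField W) {C : ℝ}
    (hdiv : ∀ x, |divergence W x| ≤ C) {u : L2 ν} (hu : u ∈ sobolevH1 ν)
    (hWu : Integrable fun x => ‖W x‖ ^ 2 * ‖u x‖ ^ 2) :
    0 ≤ kinetic u + 2 * (∫ x, divergence W x * ‖u x‖ ^ 2) +
      4 * ∫ x, ‖W x‖ ^ 2 * ‖u x‖ ^ 2 := by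
  have hWi : ∀ i, Continuous fun x => W x i := fun i =>
    (EuclideanSpace.proj i : EuclideanSpace ℝ (Fin ν) →L[ℝ] ℝ).continuous.comp hW.continuous
  have hmeas : ∀ i, AEStronglyMeasurable (fun x => W x i • u x) volume := fun i =>
    (hWi i).aestronglyMeasurable.smul (Lp.aestronglyMeasurable u)
  have hmem : ∀ i, MemLp (fun x => W x i • u x) 2 volume := fun i => by
    rw [memLp_two_iff_integrable_sq_norm (hmeas i)]
    refine hWu.mono' ((hmeas i).norm.pow 2) (.of_forall fun x => ?_)
    rw [Real.norm_of_nonneg (by positivity), norm_smul, mul_pow]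
    gcongr
    exact PiLp.norm_apply_le (W x) i
  set w : Fin ν → L2 ν := fun i => (hmem i).toLp with hwdef
  have hw : ∀ i, w i =ᵐ[volume] fun x => W x i • u x := fun i => (hmem i).coeFn_toLp
  have hwsum : ∑ i, ‖w i‖ ^ 2 = ∫ x, ‖W x‖ ^ 2 * ‖u x‖ ^ 2 := by
    simp_rw [norm_sq_eq_integral]
    rw [← integral_finsetSum _ fun i _ => integrable_norm_sq (w i)]
    refine integral_congr_ae ?_
    filter_upwards [ae_all_iff.2 hw] with x hx
    simp only [hx, norm_smul, mul_pow]
    rw [← Finset.sum_mul, EuclideanSpace.norm_sq_eq]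
  have hnonneg : 0 ≤ ∑ i, ‖weakPartial i u - (2 : ℂ) • w i‖ ^ 2 := by positivity
  have hexp : ∀ i, ‖weakPartial i u - (2 : ℂ) • w i‖ ^ 2 =
      ‖weakPartial i u‖ ^ 2 - 4 * (⟪w i, weakPartial i u⟫_ℂ).re + 4 * ‖w i‖ ^ 2 := fun i => by
    have hs : (⟪weakPartial i u, w i⟫_ℂ).re = (⟪w i, weakPartial i u⟫_ℂ).re :=
      inner_re_symm (𝕜 := ℂ) _ _
    rw [norm_sub_sq (𝕜 := ℂ), norm_smul, inner_smul_right]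
    simp [hs]
    ring
  simp_rw [hexp] at hnonneg
  rw [Finset.sum_add_distrib, Finset.sum_sub_distrib, ← Finset.mul_sum, ← Finset.mul_sum,
    hwsum] at hnonneg
  rw [integral_divergence_mul_norm_sq hW hdiv hu hWu hw, kinetic]
  linarith

/-- The bounded divergence can be subtracted from the potential, which leaves `V₁`. Then `4|W|² ≤
2|V₁| + (2V₁ - 4|W|²)₋`, and the last term is integrable against `|u|²` by the form bound. -/
theorem integrable_norm_sq_mul_of_mem_formDomain {V₁ : EuclideanSpace ℝ (Fin ν) → ℝ}
    (hW : IsLocallyLipschitzField W) {C : ℝ} (hdiv : ∀ x, |divergence W x| ≤ C)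
    (hV₁ : LocallyIntegrable V₁)
    (hbd : NegPartFormBounded fun x => 2 * V₁ x - 4 * ‖W x‖ ^ 2) {u : L2 ν}
    (hu : u ∈ formDomain fun x => V₁ x + divergence W x) :
    (Integrable fun x => divergence W x * ‖u x‖ ^ 2) ∧ (Integrable fun x => V₁ x * ‖u x‖ ^ 2) ∧
      Integrable fun x => ‖W x‖ ^ 2 * ‖u x‖ ^ 2 := by
  have hm := hV₁.aestronglyMeasurable
  have hdm := (measurable_divergence W).aestronglyMeasurable (μ := volume)
  have hu2 := integrable_norm_sq u
  have h1 : Integrable fun x => divergence W x * ‖u x‖ ^ 2 :=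
    hu2.bdd_mul (c := C) hdm (.of_forall hdiv)
  have h2 : Integrable fun x => V₁ x * ‖u x‖ ^ 2 := by
    refine ((integrable_potential_mul_norm_sq (hm.add hdm) hu).sub h1).congr
      (.of_forall fun x => ?_)
    simp only [Pi.add_apply, Pi.sub_apply]
    ring
  refine ⟨h1, h2, ?_⟩
  have hm2 : AEStronglyMeasurable (fun x => 2 * V₁ x - 4 * ‖W x‖ ^ 2) volume :=
    (hm.const_mul 2).sub (hW.continuous.norm.pow 2 |>.const_mul 4 |>.aestronglyMeasurable)
  have h3 : Integrable fun x => max (-(2 * V₁ x - 4 * ‖W x‖ ^ 2)) 0 * ‖u x‖ ^ 2 := by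
    obtain ⟨a, b, -, -, hab⟩ := hbd
    have hmm : AEStronglyMeasurable
        (fun x => max (-(2 * V₁ x - 4 * ‖W x‖ ^ 2)) 0 * ‖u x‖ ^ 2) volume :=
      (hm2.neg.sup aestronglyMeasurable_const).mul hu2.aestronglyMeasurable
    refine (lintegral_ofReal_ne_top_iff_integrable hmm (.of_forall fun x => by positivity)).1 ?_
    exact ((hab u hu.1).trans_lt ENNReal.ofReal_lt_top).ne
  refine ((h2.abs.const_mul 2).add h3).mono'
    ((hW.continuous.norm.pow 2).aestronglyMeasurable.mul hu2.aestronglyMeasurable)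
    (.of_forall fun x => ?_)
  have h4 : 0 ≤ ‖u x‖ ^ 2 := sq_nonneg _
  rw [Real.norm_of_nonneg (by positivity), Pi.add_apply, abs_mul, abs_of_nonneg h4, ← mul_assoc,
    ← add_mul]
  gcongr
  have h5 := le_max_left (-(2 * V₁ x - 4 * ‖W x‖ ^ 2)) 0
  have h6 := le_abs_self (V₁ x)
  have h7 := sq_nonneg ‖W x‖
  linarith

/-- The form inequality `-Δ + V₁ + ∇·W ≥ ½ (-Δ + 2 V₁ - 4 |W|²)`. -/
theorem formGE_of_isLocallyLipschitzField {V₁ : EuclideanSpace ℝ (Fin ν) → ℝ}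
    (hW : IsLocallyLipschitzField W) {C : ℝ} (hdiv : ∀ x, |divergence W x| ≤ C)
    (hV₁ : LocallyIntegrable V₁)
    (hbd : NegPartFormBounded fun x => 2 * V₁ x - 4 * ‖W x‖ ^ 2) :
    FormGE (fun x => V₁ x + divergence W x) (1 / 2) (fun x => 2 * V₁ x - 4 * ‖W x‖ ^ 2) := by
  intro u hu
  obtain ⟨h1, h2, h3⟩ := integrable_norm_sq_mul_of_mem_formDomain hW hdiv hV₁ hbd hu
  have hm := hV₁.aestronglyMeasurable
  have hm2 : AEStronglyMeasurable (fun x => 2 * V₁ x - 4 * ‖W x‖ ^ 2) volume :=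
    (hm.const_mul 2).sub (hW.continuous.norm.pow 2 |>.const_mul 4 |>.aestronglyMeasurable)
  refine ⟨⟨hu.1, ?_⟩, ?_⟩
  · have hms : AEStronglyMeasurable (fun x => √|2 * V₁ x - 4 * ‖W x‖ ^ 2| • u x) volume :=
      hm2.aemeasurable.abs.sqrt.aestronglyMeasurable.smul (Lp.aestronglyMeasurable u)
    refine (memLp_two_iff_integrable_sq_norm hms).2 ?_
    refine ((h2.const_mul 2).sub (h3.const_mul 4)).abs.congr (.of_forall fun x => ?_)
    simp only [Pi.sub_apply]
    rw [norm_smul, mul_pow, Real.norm_of_nonneg (Real.sqrt_nonneg _), Real.sq_sqrt (abs_nonneg _),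
      ← mul_assoc, ← mul_assoc, ← sub_mul, abs_mul, abs_of_nonneg (sq_nonneg ‖u x‖)]
  · have h4 := integral_divergence_ge hW hdiv hu.1 h3
    have e1 : ∫ x, (V₁ x + divergence W x) * ‖u x‖ ^ 2 =
        (∫ x, V₁ x * ‖u x‖ ^ 2) + ∫ x, divergence W x * ‖u x‖ ^ 2 := by
      rw [← integral_add h2 h1]
      simp only [add_mul]
    have e2 : ∫ x, (2 * V₁ x - 4 * ‖W x‖ ^ 2) * ‖u x‖ ^ 2 =
        2 * (∫ x, V₁ x * ‖u x‖ ^ 2) - 4 * ∫ x, ‖W x‖ ^ 2 * ‖u x‖ ^ 2 := by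
      rw [← integral_const_mul, ← integral_const_mul,
        ← integral_sub (h2.const_mul 2) (h3.const_mul 4)]
      simp only [sub_mul, mul_assoc]
    rw [energy, energy, e1, e2]
    linarith

/-- Since `V₁ ≥ ½ (2V₁ - 4|W|²)` and `∇·W ≥ -C`, the negative part grows by at most `C`. The
relative bound `a` is thus unchanged. -/
theorem negPartFormBounded_add_divergence {V₁ : EuclideanSpace ℝ (Fin ν) → ℝ} {C : ℝ}
    (hdiv : ∀ x, |divergence W x| ≤ C)
    (hbd : NegPartFormBounded fun x => 2 * V₁ x - 4 * ‖W x‖ ^ 2) :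
    NegPartFormBounded fun x => V₁ x + divergence W x := by
  obtain ⟨a, b, ha0, ha1, hab⟩ := hbd
  have hC : 0 ≤ C := (abs_nonneg _).trans (hdiv 0)
  refine ⟨a, |b| + C, ha0, ha1, fun u hu => ?_⟩
  have hu2 := integrable_norm_sq u
  have hk : 0 ≤ kinetic u := Finset.sum_nonneg fun i _ => by positivity
  have hpt : ∀ x, ENNReal.ofReal (max (-(V₁ x + divergence W x)) 0 * ‖u x‖ ^ 2) ≤
      ENNReal.ofReal (max (-(2 * V₁ x - 4 * ‖W x‖ ^ 2)) 0 * ‖u x‖ ^ 2) +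
        ENNReal.ofReal (C * ‖u x‖ ^ 2) := fun x => by
    rw [← ENNReal.ofReal_add (by positivity) (by positivity), ← add_mul]
    refine ENNReal.ofReal_le_ofReal (mul_le_mul_of_nonneg_right ?_ (sq_nonneg _))
    have h1 := le_max_left (-(2 * V₁ x - 4 * ‖W x‖ ^ 2)) 0
    have h2 := le_max_right (-(2 * V₁ x - 4 * ‖W x‖ ^ 2)) 0
    have h3 := (abs_le.1 (hdiv x)).1
    have h4 := sq_nonneg ‖W x‖
    refine max_le ?_ (by linarith)
    linarith
  calc _ ≤ ∫⁻ x, (ENNReal.ofReal (max (-(2 * V₁ x - 4 * ‖W x‖ ^ 2)) 0 * ‖u x‖ ^ 2) +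
        ENNReal.ofReal (C * ‖u x‖ ^ 2)) := lintegral_mono hpt
    _ = (∫⁻ x, ENNReal.ofReal (max (-(2 * V₁ x - 4 * ‖W x‖ ^ 2)) 0 * ‖u x‖ ^ 2)) +
        ENNReal.ofReal (C * ‖u‖ ^ 2) := by
      rw [lintegral_add_right' _ (hu2.const_mul C).aestronglyMeasurable.aemeasurable.ennreal_ofReal,
        norm_sq_eq_integral, ← integral_const_mul, ofReal_integral_eq_lintegral_ofReal
          (hu2.const_mul C) (.of_forall fun x => by positivity)]
    _ ≤ ENNReal.ofReal (a * kinetic u + |b| * ‖u‖ ^ 2) + ENNReal.ofReal (C * ‖u‖ ^ 2) := by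
      refine add_le_add ((hab u hu).trans (ENNReal.ofReal_le_ofReal ?_)) le_rfl
      gcongr
      exact le_abs_self b
    _ = _ := by
      rw [← ENNReal.ofReal_add (by positivity) (by positivity)]
      congr 1
      ring

end FormInequality

end Schrodinger

end

theorem theorem2p2 {ν : ℕ} (hν : 1 ≤ ν)
    (V₁ : EuclideanSpace ℝ (Fin ν) → ℝ)
    (W : EuclideanSpace ℝ (Fin ν) → EuclideanSpace ℝ (Fin ν))
    (hW : Schrodinger.IsRegularField W)
    (hdiv : ∃ C : ℝ, ∀ x, |Schrodinger.divergence W x| ≤ C)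
    (hV₁ : LocallyIntegrable V₁)
    (hbd : Schrodinger.NegPartFormBounded fun x => 2 * V₁ x - 4 * ‖W x‖ ^ 2) :
    IsSelfAdjoint (Schrodinger.hamiltonian fun x => V₁ x + Schrodinger.divergence W x) ∧
    IsSelfAdjoint (Schrodinger.hamiltonian fun x => 2 * V₁ x - 4 * ‖W x‖ ^ 2) ∧
    Schrodinger.FormGE (fun x => V₁ x + Schrodinger.divergence W x) (1 / 2)
      (fun x => 2 * V₁ x - 4 * ‖W x‖ ^ 2) ∧
    Schrodinger.N (fun x => V₁ x + Schrodinger.divergence W x) ≤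
      Schrodinger.N (fun x => 2 * V₁ x - 4 * ‖W x‖ ^ 2) ∧
    ∀ p : ℝ, 0 < p →
      Schrodinger.E p (fun x => V₁ x + Schrodinger.divergence W x) ≤
        ENNReal.ofReal (2 ^ (-p)) * Schrodinger.E p (fun x => 2 * V₁ x - 4 * ‖W x‖ ^ 2) := by
  have hWl := hW.isLocallyLipschitzField hdiv
  obtain ⟨C, hC⟩ := hdiv
  have hge := Schrodinger.formGE_of_isLocallyLipschitzField hWl hC hV₁ hbd
  have hloc : LocallyIntegrable fun x => V₁ x + Schrodinger.divergence W x := by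
    refine hV₁.add ((locallyIntegrable_const C).mono
      (Schrodinger.measurable_divergence W).aestronglyMeasurable (.of_forall fun x => ?_))
    exact (hC x).trans (le_abs_self C)
  have hloc' : LocallyIntegrable fun x => 2 * V₁ x - 4 * ‖W x‖ ^ 2 :=
    (hV₁.smul (2 : ℝ)).sub ((hWl.continuous.norm.pow 2).const_mul 4).locallyIntegrable
  obtain ⟨K₁, _, _, _, c₁, j₁, hmem₁, -, hnorm₁, hA⟩ :=
    Schrodinger.exists_formSpace_hamiltonian hloc
      (Schrodinger.negPartFormBounded_add_divergence hC hbd)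
  obtain ⟨K₂, _, _, _, c₂, j₂, -, hsurj₂, hnorm₂, hB⟩ :=
    Schrodinger.exists_formSpace_hamiltonian hloc' hbd
  -- Subtracting the shifts `c₁` and `c₂` from the form norms recovers the energies, so this is the
  -- form inequality transported to the two form spaces.
  have hcmp : ∀ k₁, ∃ k₂, j₂ k₂ = j₁ k₁ ∧
      (1 / 2 : ℝ) * (‖k₂‖ ^ 2 - c₂ * ‖j₁ k₁‖ ^ 2) ≤ ‖k₁‖ ^ 2 - c₁ * ‖j₁ k₁‖ ^ 2 := fun k₁ => by
    obtain ⟨hmem, hle⟩ := hge _ (hmem₁ k₁)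
    obtain ⟨k₂, hk⟩ := hsurj₂ _ hmem
    refine ⟨k₂, hk, ?_⟩
    rw [hnorm₁, hnorm₂, hk]
    linarith
  refine ⟨hA.isSelfAdjoint_generator, hB.isSelfAdjoint_generator, hge,
    hA.numNegative_le hB one_half_pos hcmp, fun p hp => ?_⟩
  have h := hA.liebThirring_le hB one_half_pos hcmp hp
  rwa [one_div, Real.inv_rpow zero_le_two, ← Real.rpow_neg zero_le_two] at h
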